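/- Let $k$ be a field, let $1\le n\le m$, let $R=k[x_{ij}\mid 1\le i\le n,\ 1\le j\le m]$ with the standard grading, and let $M=(x_{ij})$ be the generic $n\times m$ matrix. Let $<$ be the lexicographic monomial order on $R$ with $x_{11}>x_{12}>\cdots>x_{1m}>x_{21}>\cdots>x_{nm}$. Let $\Delta$ be an $(n-1)$-pure simplicial complex on vertices in $[m]=\{1,\dots,m\}$, i.e. every facet of $\Delta$ has exactly $n$ elements. Let $J_\Delta\subseteq R$ be its $n$-determinantal facet ideal, generated by the maximal minors of $M$ on the column sets $\sigma$, for $\sigma$ a facet of $\Delta$, and let $\operatorname{in}_<(J_\Delta)$ be the ideal generated by the leading terms of the elements of $J_\Delta$. Let $\Delta^{\mathrm{clique}}$ be the clique complex of $\Delta$, whose faces are the subsets of $[m]$ all of whose $n$-element subsets are faces of $\Delta$. A $1$-nonface of a simplicial complex $\Gamma$ is a set $\sigma=\{\sigma_1<\cdots<\sigma_\ell\}\notin\Gamma$ such that $\sigma\setminus\{\sigma_j\}\in\Gamma$ and $\sigma\setminus\{\sigma_{j+1}\}\in\Gamma$ for some $1\le j<\ell$. Assume that $\Delta^{\mathrm{clique}}$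 has no $1$-nonfaces of cardinality $n+1$ (this holds in particular if $\Delta$ itself has none). Then for all $i\ge 1$, $$\beta_{i,n+i}(J_\Delta)=\beta_{i,n+i}(\operatorname{in}_<(J_\Delta)),$$ where, for a homogeneous ideal $I$, $\beta_{i,j}(I)$ is the number of basis elements of degree $j$ in homological degree $i$ of a minimal graded free resolution of $I$ as an $R$-module. -/

import Mathlib

namespace DetFacet

/-! ### Simplicial complexes on the vertices `Fin m` (that is, `1, …, m`)

A simplicial complex is Mathlib's `PreAbstractSimplicialComplex (Fin m)`, a downward closed set of
nonempty finite sets; the empty face is left implicit and vertices outside the complex are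
allowed. -/

/-- The facets, i.e. the inclusion-maximal faces. -/
def IsFacet {m : ℕ} (Δ : PreAbstractSimplicialComplex (Fin m)) (σ : Finset (Fin m)) : Prop :=
  Maximal (fun τ => τ ∈ Δ) σ

/-- `Δ` is `(n-1)`-pure: every facet has exactly `n` vertices. -/
def IsPureCard {m : ℕ} (n : ℕ) (Δ : PreAbstractSimplicialComplex (Fin m)) : Prop :=
  ∀ σ, IsFacet Δ σ → σ.card = n

/-- The clique complex of an `(n-1)`-pure complex: its faces are the cliques, i.e. the sets all of
whose `n`-element subsets are faces of `Δ`. -/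
def cliqueComplex {m : ℕ} (n : ℕ) (Δ : PreAbstractSimplicialComplex (Fin m)) :
    PreAbstractSimplicialComplex (Fin m) where
  faces := {σ | σ.Nonempty ∧ ∀ τ ⊆ σ, τ.card = n → τ ∈ Δ}
  isRelLowerSet_faces := fun _ hσ =>
    ⟨hσ.1, fun _ hτσ hτ => ⟨hτ, fun ρ hρ hc => hσ.2 ρ (hρ.trans hτσ) hc⟩⟩

/-- `σ = {σ_0 < ⋯ < σ_{ℓ-1}}` is an `i`-nonface of `Δ`: it is not a face, and there are `i + 1`
consecutive elements `σ_j, …, σ_{j+i}` of `σ` such that deleting any one of them gives a face. -/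
def IsINonface {m : ℕ} (Δ : PreAbstractSimplicialComplex (Fin m)) (i : ℕ) (σ : Finset (Fin m)) :
    Prop :=
  σ ∉ Δ ∧ ∃ (j : ℕ) (h : j + i < σ.card), ∀ (k : ℕ) (hk : k ≤ i),
    σ.erase (σ.orderEmbOfFin rfl ⟨j + k, by omega⟩) ∈ Δ

/-- If `Δ` has no `1`-nonface of cardinality `n + 1`, then neither has its clique complex. So a
hypothesis on the clique complex is the weaker one. -/
theorem cliqueComplex_no_oneNonface {m n : ℕ} (hn : 1 ≤ n)
    {Δ : PreAbstractSimplicialComplex (Fin m)}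
    (h : ∀ σ : Finset (Fin m), σ.card = n + 1 → ¬ IsINonface Δ 1 σ)
    (σ : Finset (Fin m)) (hσ : σ.card = n + 1) : ¬ IsINonface (cliqueComplex n Δ) 1 σ := by
  rintro ⟨hnot, j, hj, hk⟩
  refine h σ hσ ⟨fun hmem => hnot ⟨?_, fun τ hτ hc => ?_⟩, j, hj, fun k hk' => ?_⟩
  · exact Finset.card_pos.mp (by omega)
  · exact (Δ.isRelLowerSet_faces hmem).2 hτ (Finset.card_pos.mp (by omega))
  · refine (hk k hk').2 _ subset_rfl ?_
    rw [Finset.card_erase_of_mem (Finset.orderEmbOfFin_mem σ rfl _), hσ]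
    rfl

/-! ### Determinantal facet ideals and initial ideals -/

/-- `R = k[x_{ij}]`, `1 ≤ i ≤ n`, `1 ≤ j ≤ m`. The index type carries the lexicographic order, so
that the variables are ordered `x_{11} > x_{12} > ⋯ > x_{1m} > x_{21} > ⋯ > x_{nm}`. -/
abbrev PolyRing (k : Type*) [Field k] (n m : ℕ) : Type _ := MvPolynomial (Fin n ×ₗ Fin m) k

/-- The generic `n × m` matrix `(x_{ij})`. -/
noncomputable def genericMatrix (k : Type*) [Field k] (n m : ℕ) :
    Matrix (Fin n) (Fin m) (PolyRing k n m) :=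
  Matrix.of fun i j => MvPolynomial.X (toLex (i, j))

/-- The maximal minor of the generic matrix on the columns in `σ`, taken in increasing order. -/
noncomputable def maximalMinor (k : Type*) [Field k] {n m : ℕ} (σ : Finset (Fin m))
    (hσ : σ.card = n) : PolyRing k n m :=
  ((genericMatrix k n m).submatrix id (σ.orderEmbOfFin hσ)).det

/-- The `n`-determinantal facet ideal `J_Δ`, generated by the maximal minors on the facets. -/
noncomputable def facetIdeal (k : Type*) [Field k] (n : ℕ) {m : ℕ}
    (Δ : PreAbstractSimplicialComplex (Fin m)) : Ideal (PolyRing k n m) :=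
  Ideal.span {p | ∃ (σ : Finset (Fin m)) (_ : IsFacet Δ σ) (hσ : σ.card = n),
    p = maximalMinor k σ hσ}

/-- The initial ideal of `I`, generated by the leading terms of all elements of `I` with respect
to the lexicographic order. -/
noncomputable def initialIdeal {k : Type*} [Field k] {n m : ℕ} (I : Ideal (PolyRing k n m)) :
    Ideal (PolyRing k n m) :=
  Ideal.span ((MonomialOrder.lex (σ := Fin n ×ₗ Fin m)).leadingTerm '' (I : Set (PolyRing k n m)))

/-! ### Minimal graded free resolutions and graded Betti numbers -/

/-- The element `v` of the graded free module `⨁_b S(-deg b)` over the standard graded polynomial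
ring `S = k[x_s : s ∈ ι]` is homogeneous of degree `j`. -/
def IsHomogeneousVec {k ι : Type*} [Field k] {r : ℕ} (deg : Fin r → ℕ)
    (v : Fin r → MvPolynomial ι k) (j : ℕ) : Prop :=
  ∀ b, ∀ e ∈ (v b).support, e.degree + deg b = j

/-- A minimal graded free resolution
`⋯ → F_2 → F_1 → F_0 → I → 0` of an ideal `I` of the standard graded polynomial ring, with
`F_i = ⨁_b S(-deg i b)` of finite rank. -/
structure MinimalGradedFreeResolution {k ι : Type*} [Field k] (I : Ideal (MvPolynomial ι k)) where
  /-- the rank of `F_i` -/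
  rank : ℕ → ℕ
  /-- the degrees of the basis elements of `F_i` -/
  deg : ∀ i, Fin (rank i) → ℕ
  /-- the augmentation `F_0 → I ⊆ S` -/
  aug : (Fin (rank 0) → MvPolynomial ι k) →ₗ[MvPolynomial ι k] MvPolynomial ι k
  /-- the differential `F_{i+1} → F_i` -/
  d : ∀ i, (Fin (rank (i + 1)) → MvPolynomial ι k) →ₗ[MvPolynomial ι k]
    (Fin (rank i) → MvPolynomial ι k)
  /-- the augmentation preserves degrees -/
  aug_homogeneous : ∀ a, (aug (Pi.single a 1)).IsHomogeneous (deg 0 a)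
  /-- the differentials preserve degrees -/
  d_homogeneous : ∀ i a, IsHomogeneousVec (deg i) (d i (Pi.single a 1)) (deg (i + 1) a)
  range_aug : LinearMap.range aug = I
  exact_aug : Function.Exact (d 0) aug
  exact_d : ∀ i, Function.Exact (d (i + 1)) (d i)
  /-- minimality: the image of each differential lies in `𝔪 F_i`, where `𝔪` is the ideal of
  polynomials without constant term -/
  minimal : ∀ i v b, MvPolynomial.constantCoeff (d i v b) = 0

/-- The graded Betti number `β_{i,j}(I)`, read off from a minimal graded free resolution: the
number of basis elements of degree `j` in `F_i`. -/
def MinimalGradedFreeResolution.betti {k ι : Type*} [Field k] {I : Ideal (MvPolynomial ι k)}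
    (F : MinimalGradedFreeResolution I) (i j : ℕ) : ℕ :=
  (Finset.univ.filter fun b => F.deg i b = j).card

end DetFacet

/-!
Let `I` be `J_Δ` or `in(J_Δ)`. Since `I ⊆ 𝔪ⁿ`, its Betti numbers on the linear strand are Koszul
homology in degrees where there are no boundaries: `β_{i,n+i}(I)` is the dimension of the space of
Koszul `i`-cycles with coefficients in the degree `n` part of `I`.

The terms of the lex-largest multidegree of a cycle are diagonal monomials of faces of `Δ`, and the
Koszul relation exchanges their variables with the indices of the cycle. Hence this multidegree is
squarefree and consists of a nonempty set of columns in each row, each to the right of the previous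
one, such that all transversals are faces of `Δ`. In the absence of `1`-nonfaces of cardinality
`n + 1` the columns then form a clique. So the dimension is at most the number of these block sets.

Conversely, the determinants of the generic matrix bordered by unit rows and restricted to the
columns of a block set are the coefficients of a cycle over `J_Δ`, coming from the Eagon–Northcott
complex. Its leading multidegree is the given block set, and its component in that multidegree is
a cycle over `in(J_Δ)`. So both Betti numbers count the block sets.
-/

namespace DetFacet

open MvPolynomial

/-! ### Polynomials of small degree -/

section LowDegree

variable {R ι : Type*} [CommRing R]

theorem coeff_mul_of_mem_pow_idealOfVars {d : ℕ} {q : MvPolynomial ι R}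
    (hq : q ∈ idealOfVars ι R ^ d) (p : MvPolynomial ι R) {e : ι →₀ ℕ} (he : e.degree ≤ d) :
    coeff e (p * q) = constantCoeff p * coeff e q := by
  classical
  rw [coeff_mul, Finset.sum_eq_single (0, e)]
  · rfl
  · rintro ⟨a, b⟩ hab hne
    rw [Finset.HasAntidiagonal.mem_antidiagonal] at hab
    have hadd : a.degree + b.degree = e.degree := by rw [← map_add, hab]
    have ha : a.degree ≠ 0 := fun h => hne <| by
      obtain rfl := (Finsupp.degree_eq_zero_iff a).1 h
      simpa using hab
    rw [(mem_pow_idealOfVars_iff' d q).1 hq b (by omega), mul_zero]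
  · simp

theorem homogeneousComponent_mul_of_mem_pow_idealOfVars {d : ℕ} {q : MvPolynomial ι R}
    (hq : q ∈ idealOfVars ι R ^ d) (p : MvPolynomial ι R) :
    homogeneousComponent d (p * q) = constantCoeff p • homogeneousComponent d q := by
  ext e
  by_cases he : e.degree = d
  · simp [coeff_homogeneousComponent, he, coeff_mul_of_mem_pow_idealOfVars hq p he.le]
  · simp [coeff_homogeneousComponent, he]

theorem isHomogeneous_iff_degree_eq {d : ℕ} {p : MvPolynomial ι R} :
    p.IsHomogeneous d ↔ ∀ e ∈ p.support, e.degree = d := by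
  have weight_eq_degree (e : ι →₀ ℕ) : Finsupp.weight 1 e = e.degree :=
    (congrArg (fun φ => φ e) Finsupp.degree_eq_weight_one).symm
  simp only [IsHomogeneous, IsWeightedHomogeneous, mem_support_iff, weight_eq_degree]

theorem mem_pow_idealOfVars_of_isHomogeneous {d : ℕ} {p : MvPolynomial ι R}
    (hp : p.IsHomogeneous d) : p ∈ idealOfVars ι R ^ d :=
  (mem_pow_idealOfVars_iff' d p).2 fun _ he => hp.coeff_eq_zero he.ne

/-- The space of forms of degree `d` in an ideal. -/
noncomputable def homogeneousPart (I : Ideal (MvPolynomial ι R)) (d : ℕ) :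
    Submodule R (MvPolynomial ι R) :=
  I.restrictScalars R ⊓ homogeneousSubmodule ι R d

theorem homogeneousComponent_mem_span {d : ℕ} {S : Set (MvPolynomial ι R)}
    (hS : S ⊆ (idealOfVars ι R ^ d : Ideal _)) {p : MvPolynomial ι R} (hp : p ∈ Ideal.span S) :
    homogeneousComponent d p ∈ Submodule.span R (homogeneousComponent d '' S) := by
  induction hp using Submodule.span_induction with
  | mem q hq => exact Submodule.subset_span ⟨q, hq, rfl⟩
  | zero => simp
  | add q q' _ _ hq hq' => rw [map_add]; exact Submodule.add_mem _ hq hq'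
  | smul r q hq ih =>
    rw [smul_eq_mul, homogeneousComponent_mul_of_mem_pow_idealOfVars (Ideal.span_le.2 hS hq)]
    exact Submodule.smul_mem _ _ ih

variable [Fintype ι]

theorem coeff_single_sum_X_mul_C (y : ι → R) (w : ι) :
    coeff (Finsupp.single w 1) (∑ v, X v * C (y v)) = y w := by
  classical
  simp [coeff_sum, mul_comm (X _), coeff_C_mul, coeff_X, Finsupp.single_left_inj]

theorem eq_sum_X_mul_C_of_isHomogeneous_one {p : MvPolynomial ι R} (hp : p.IsHomogeneous 1) :
    p = ∑ w, X w * C (coeff (Finsupp.single w 1) p) := by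
  have hsum : (∑ w, X w * C (coeff (Finsupp.single w 1) p)).IsHomogeneous 1 :=
    IsHomogeneous.sum _ _ _ fun w _ => (isHomogeneous_X R w).mul (isHomogeneous_C ι _)
  ext e
  by_cases he : e.degree = 1
  · obtain ⟨w, rfl⟩ := (Finsupp.sum_eq_one_iff e).1 he
    rw [coeff_single_sum_X_mul_C]
  · rw [hp.coeff_eq_zero he, hsum.coeff_eq_zero he]

theorem apply_self_eq_zero_and_antisymm_of_sum_X_mul_X_eq_zero (a : ι → ι → R)
    (h : ∑ v, X v * ∑ w, X w * C (a v w) = 0) :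
    (∀ v, a v v = 0) ∧ ∀ v w, v ≠ w → a v w = -a w v := by
  classical
  have coeff_X_mul_X_mul_C : ∀ v w x y, coeff (Finsupp.single v 1 + Finsupp.single w 1)
      (X x * (X y * C (a x y))) = if x = v ∧ y = w ∨ x = w ∧ y = v then a x y else 0 := by
    intro v w x y
    rw [← mul_assoc, mul_comm, coeff_C_mul, X, X, monomial_mul, one_mul, coeff_monomial,
      mul_ite, mul_one, mul_zero]
    refine if_congr ?_ rfl rfl
    rw [Finsupp.single_add_single_eq_single_add_single one_ne_zero one_ne_zero]
    simp
  have coeff_eq_zero (v w : ι) :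
      ∑ x, ∑ y, (if x = v ∧ y = w ∨ x = w ∧ y = v then a x y else 0) = 0 := by
    have := congrArg (coeff (Finsupp.single v 1 + Finsupp.single w 1)) h
    simpa only [Finset.mul_sum, coeff_sum, coeff_zero, coeff_X_mul_X_mul_C] using this
  refine ⟨fun v => ?_, fun v w hvw => ?_⟩
  · simpa [ite_and] using coeff_eq_zero v v
  · have hsplit : ∀ x y, (if x = v ∧ y = w ∨ x = w ∧ y = v then a x y else 0) =
        (if x = v then if y = w then a x y else 0 else 0) +
          if x = w then if y = v then a x y else 0 else 0 := by
      intro x y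
      grind
    simpa [hsplit, Finset.sum_add_distrib, ← eq_neg_iff_add_eq_zero] using coeff_eq_zero v w

end LowDegree

/-! ### Koszul cycles -/

section Koszul

theorem eq_cons_cons {ι : Type*} {i : ℕ} (v : Fin (i + 2) → ι) :
    v = Fin.cons (v 0) (Fin.cons (v 1) (Fin.tail (Fin.tail v)) : Fin (i + 1) → ι) := by
  rw [← Fin.cons_self_tail v, ← Fin.cons_self_tail (Fin.tail v)]
  rfl

theorem cons_cons_comp_swap {ι : Type*} {i : ℕ} (x y : ι) (v : Fin i → ι) :
    (Fin.cons x (Fin.cons y v : Fin (i + 1) → ι) : Fin (i + 2) → ι) ∘ Equiv.swap 0 1 =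
      Fin.cons y (Fin.cons x v : Fin (i + 1) → ι) := by
  refine (eq_cons_cons _).trans ?_
  simp only [Function.comp_apply, Equiv.swap_apply_left, Equiv.swap_apply_right]
  rfl

/-- `c` is an alternating function of a tuple of elements of `ι`; it stands for the element
`∑ c v • (e_{v_1} ∧ ⋯ ∧ e_{v_i})` of an exterior power, the sum being over unordered tuples. -/
structure IsAlternating {κ ι M : Type*} [Fintype κ] [DecidableEq κ] [AddCommGroup M]
    (c : (κ → ι) → M) : Prop where
  apply_eq_zero : ∀ v, ¬ Function.Injective v → c v = 0
  apply_comp_perm : ∀ v (π : Equiv.Perm κ), c (v ∘ π) = Equiv.Perm.sign π • c v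

namespace IsAlternating

variable {κ ι M : Type*} [Fintype κ] [DecidableEq κ] [AddCommGroup M] {c c' : (κ → ι) → M}

theorem zero : IsAlternating (0 : (κ → ι) → M) := ⟨by simp, by simp⟩

theorem add (hc : IsAlternating c) (hc' : IsAlternating c') : IsAlternating (c + c') where
  apply_eq_zero v hv := by simp [hc.apply_eq_zero v hv, hc'.apply_eq_zero v hv]
  apply_comp_perm v π := by simp [hc.apply_comp_perm, hc'.apply_comp_perm]

theorem comp_linearMap {R N : Type*} [Semiring R] [AddCommGroup N] [Module R M] [Module R N]
    (hc : IsAlternating c) (f : M →ₗ[R] N) : IsAlternating fun v => f (c v) where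
  apply_eq_zero v hv := by simp [hc.apply_eq_zero v hv]
  apply_comp_perm v π := by simp [hc.apply_comp_perm, Units.smul_def]

theorem smul {R : Type*} [CommSemiring R] [Module R M] (hc : IsAlternating c) (r : R) :
    IsAlternating (r • c) :=
  hc.comp_linearMap (LinearMap.lsmul R M r)

theorem apply_comp_perm_eq_or (hc : IsAlternating c) (v : κ → ι) (π : Equiv.Perm κ) :
    c (v ∘ π) = c v ∨ c (v ∘ π) = -c v := by
  rcases Int.units_eq_one_or (Equiv.Perm.sign π) with h | h <;> simp [hc.apply_comp_perm, h]

theorem apply_comp_swap (hc : IsAlternating c) (v : κ → ι) {a b : κ} (hab : a ≠ b) :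
    c (v ∘ Equiv.swap a b) = -c v := by
  simp [hc.apply_comp_perm, Equiv.Perm.sign_swap hab]

theorem cons {i : ℕ} {c : (Fin (i + 1) → ι) → M} (hc : IsAlternating c) (w : ι) :
    IsAlternating fun v => c (Fin.cons w v) where
  apply_eq_zero v hv := hc.apply_eq_zero _ fun h => hv (Fin.cons_injective_iff.1 h).2
  apply_comp_perm v π := by
    have hcons : (Fin.cons w (v ∘ π) : Fin (i + 1) → ι) =
        Fin.cons w v ∘ Equiv.Perm.decomposeFin.symm (0, π) := by
      funext x
      cases x using Fin.cases <;> simp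
    simp [hcons, hc.apply_comp_perm, Equiv.Perm.decomposeFin.symm_sign]

theorem of_swap_adjacent {i : ℕ} {c : (Fin (i + 2) → ι) → M}
    (hswap : ∀ v (j : Fin (i + 1)), c (v ∘ Equiv.swap j.castSucc j.succ) = -c v)
    (hzero : ∀ v, v 0 = v 1 → c v = 0) : IsAlternating c := by
  have comp_perm : ∀ (π : Equiv.Perm (Fin (i + 2))) v,
      c (v ∘ π) = Equiv.Perm.sign π • c v := by
    intro π
    have hπ := Submonoid.mem_top π
    rw [← Equiv.Perm.mclosure_swap_castSucc_succ] at hπ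
    induction hπ using Submonoid.closure_induction with
    | mem _ h =>
      obtain ⟨j, rfl⟩ := h
      intro v
      rw [hswap, Equiv.Perm.sign_swap (Fin.castSucc_lt_succ).ne, Units.neg_smul, one_smul]
    | one => simp
    | mul π ρ _ _ hπ hρ =>
      intro v
      rw [Equiv.Perm.coe_mul, ← Function.comp_assoc, hρ, hπ, map_mul, mul_comm, mul_smul]
  refine ⟨fun v hv => ?_, fun v π => comp_perm π v⟩
  obtain ⟨a, b, hab, hne⟩ := Function.not_injective_iff.1 hv
  let π : Equiv.Perm (Fin (i + 2)) := Equiv.swap 0 a * Equiv.swap 1 (Equiv.swap 0 a b)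
  have hπ_zero : π 0 = a := by
    have hb : (0 : Fin (i + 2)) ≠ Equiv.swap 0 a b := fun h =>
      hne (by simpa using congrArg (Equiv.swap 0 a) h)
    simp [π, Equiv.swap_apply_of_ne_of_ne Fin.zero_ne_one hb]
  have hπ_one : π 1 = b := by simp [π]
  have := hzero (v ∘ π) (by simp [hπ_zero, hπ_one, hab])
  rwa [comp_perm, smul_eq_zero_iff_eq] at this

theorem of_cons {i : ℕ} {c : (Fin (i + 2) → ι) → M}
    (hc : ∀ w, IsAlternating fun v : Fin (i + 1) → ι => c (Fin.cons w v))
    (hzero : ∀ x v, c (Fin.cons x (Fin.cons x v : Fin (i + 1) → ι)) = 0)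
    (hswap : ∀ x y v, x ≠ y → c (Fin.cons x (Fin.cons y v : Fin (i + 1) → ι)) =
      -c (Fin.cons y (Fin.cons x v : Fin (i + 1) → ι))) :
    IsAlternating c := by
  refine of_swap_adjacent (fun v j => ?_) fun v h => ?_
  · induction j using Fin.cases with
    | zero =>
      rw [Fin.castSucc_zero, Fin.succ_zero_eq_one, eq_cons_cons v, cons_cons_comp_swap]
      by_cases h : v 1 = v 0
      · simp [h, hzero]
      · exact hswap _ _ _ h
    | succ j =>
      have hv : v ∘ Equiv.swap j.succ.castSucc j.succ.succ =
          Fin.cons (v 0) (Fin.tail v ∘ Equiv.swap j.castSucc j.succ) := by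
        funext x
        cases x using Fin.cases
        · simp [Equiv.swap_apply_def, Fin.ext_iff]
        · simp [← (Fin.succ_injective _).map_swap, Fin.tail]
      rw [hv, (hc (v 0)).apply_comp_swap _ (Fin.castSucc_lt_succ).ne, Fin.cons_self_tail]
  · rw [eq_cons_cons v, ← h, hzero]

end IsAlternating

theorem update_eq_update_comp_swap {κ ι : Type*} [DecidableEq κ] (v : κ → ι) (j j' : κ) (w : ι) :
    Function.update v j w =
      Function.update (v ∘ Equiv.swap j' j) j' w ∘ Equiv.swap j' j := by
  have h := Function.update_comp_equiv (v ∘ Equiv.swap j' j) (Equiv.swap j' j) j' w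
  rw [Equiv.symm_swap, Equiv.swap_apply_left, Function.comp_assoc, ← Equiv.Perm.coe_mul,
    Equiv.swap_mul_self, Equiv.Perm.coe_one, Function.comp_id] at h
  exact h.symm

variable {R ι : Type*} [CommRing R] [Fintype ι]

theorem IsAlternating.sum_X_mul_update_eq_zero {κ : Type*} [Fintype κ] [DecidableEq κ]
    {c : (κ → ι) → MvPolynomial ι R} (hc : IsAlternating c) {j₀ : κ}
    (h : ∀ v, ∑ w, X w * c (Function.update v j₀ w) = 0) (v : κ → ι) (j : κ) :
    ∑ w, X w * c (Function.update v j w) = 0 := by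
  rcases eq_or_ne j₀ j with rfl | hj
  · exact h v
  · simp only [update_eq_update_comp_swap v j j₀, hc.apply_comp_swap _ hj, mul_neg,
      Finset.sum_neg_distrib, h, neg_zero]

/-- The Koszul cycles of homological degree `i` with coefficients in a space `P` of polynomials,
written as alternating functions of the indices of the variables. -/
def koszulCycles (P : Submodule R (MvPolynomial ι R)) (i : ℕ) :
    Submodule R ((Fin i → ι) → MvPolynomial ι R) where
  carrier := {c | (∀ v, c v ∈ P) ∧ IsAlternating c ∧
    ∀ v j, ∑ w, X w * c (Function.update v j w) = 0}
  zero_mem' := ⟨by simp, .zero, by simp⟩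
  add_mem' := fun ⟨hP, halt, hsum⟩ ⟨hP', halt', hsum'⟩ =>
    ⟨fun v => P.add_mem (hP v) (hP' v), halt.add halt', by
      simp [mul_add, Finset.sum_add_distrib, hsum, hsum']⟩
  smul_mem' := fun r _ ⟨hP, halt, hsum⟩ =>
    ⟨fun v => P.smul_mem r (hP v), halt.smul r, by simp [← Finset.smul_sum, hsum]⟩

theorem koszulCycles_cons {P : Submodule R (MvPolynomial ι R)} {i : ℕ}
    {c : (Fin (i + 1) → ι) → MvPolynomial ι R} (hc : c ∈ koszulCycles P (i + 1)) (w : ι) :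
    (fun v => c (Fin.cons w v)) ∈ koszulCycles P i :=
  ⟨fun _ => hc.1 _, hc.2.1.cons w, fun v j => by
    simpa only [← Fin.cons_update] using hc.2.2 (Fin.cons w v) j.succ⟩

theorem koszulCycles_of_cons {P : Submodule R (MvPolynomial ι R)} {i : ℕ}
    {c : (Fin (i + 2) → ι) → MvPolynomial ι R}
    (hc : ∀ w, (fun v => c (Fin.cons w v)) ∈ koszulCycles P (i + 1))
    (hzero : ∀ x v, c (Fin.cons x (Fin.cons x v : Fin (i + 1) → ι)) = 0)
    (hswap : ∀ x y v, x ≠ y → c (Fin.cons x (Fin.cons y v : Fin (i + 1) → ι)) =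
      -c (Fin.cons y (Fin.cons x v : Fin (i + 1) → ι))) :
    c ∈ koszulCycles P (i + 2) := by
  have halt : IsAlternating c := .of_cons (fun w => (hc w).2.1) hzero hswap
  refine ⟨fun v => ?_, halt, halt.sum_X_mul_update_eq_zero (j₀ := 1) fun v => ?_⟩
  · simpa using (hc (v 0)).1 (Fin.tail v)
  · rw [← Fin.cons_self_tail v, ← Fin.succ_zero_eq_one]
    simpa only [Fin.cons_update] using (hc (v 0)).2.2 (Fin.tail v) 0

theorem sum_X_mul_const_eq_zero_of_mem_koszulCycles {P : Submodule R (MvPolynomial ι R)}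
    {c : (Fin 1 → ι) → MvPolynomial ι R} (hc : c ∈ koszulCycles P 1) :
    ∑ w, X w * c (fun _ => w) = 0 := by
  rcases isEmpty_or_nonempty ι with _ | ⟨⟨x⟩⟩
  · exact Fintype.sum_empty _
  · have hsum := hc.2.2 (fun _ => x) 0
    simp only [Function.update_eq_const_of_subsingleton] at hsum
    exact hsum

theorem exists_exchange_of_mem_koszulCycles {P : Submodule R (MvPolynomial ι R)} {i : ℕ}
    {c : (Fin i → ι) → MvPolynomial ι R} (hc : c ∈ koszulCycles P i) {v : Fin i → ι}
    {e : ι →₀ ℕ} (he : coeff e (c v) ≠ 0) (j : Fin i) :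
    ∃ w ≠ v j, ∃ e', coeff e' (c (Function.update v j w)) ≠ 0 ∧
      Finsupp.single w 1 + e' = Finsupp.single (v j) 1 + e := by
  classical
  have hsum := congrArg (coeff (Finsupp.single (v j) 1 + e)) (hc.2.2 v j)
  rw [coeff_sum, coeff_zero] at hsum
  obtain ⟨w, hw, hcoeff⟩ : ∃ w ≠ v j, coeff (Finsupp.single (v j) 1 + e)
      (X w * c (Function.update v j w)) ≠ 0 := by
    by_contra! h
    rw [Finset.sum_eq_single (v j) (fun w _ hw => h w hw) (by simp), coeff_X_mul,
      Function.update_eq_self] at hsum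
    exact he hsum
  rw [coeff_X_mul', ite_ne_right_iff] at hcoeff
  refine ⟨w, hw, _, hcoeff.2, add_tsub_cancel_of_le ?_⟩
  rw [Finsupp.single_le_iff]
  exact Nat.one_le_iff_ne_zero.2 (Finsupp.mem_support_iff.1 hcoeff.1)

end Koszul

/-! ### The linear strand of a minimal graded free resolution -/

section ConstantVectors

variable {k ι : Type*} [Field k] {r : ℕ} {deg : Fin r → ℕ} {N : ℕ}

/-- The inclusion into `⨁_a S(-deg a)` of the `k`-span of the basis vectors of degree `N`. -/
noncomputable def constantVec (deg : Fin r → ℕ) (N : ℕ) :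
    ({a // deg a = N} → k) →ₗ[k] (Fin r → MvPolynomial ι k) :=
  (Algebra.linearMap k (MvPolynomial ι k)).compLeft (Fin r) ∘ₗ
    Function.ExtendByZero.linearMap k Subtype.val

theorem constantVec_of_eq (z : {a // deg a = N} → k) {a : Fin r} (h : deg a = N) :
    constantVec (ι := ι) deg N z a = C (z ⟨a, h⟩) :=
  congrArg C (Subtype.val_injective.extend_apply z 0 ⟨a, h⟩)

theorem constantVec_of_ne (z : {a // deg a = N} → k) {a : Fin r} (h : deg a ≠ N) :
    constantVec (ι := ι) deg N z a = 0 := by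
  have : Function.extend Subtype.val z 0 a = 0 :=
    Function.extend_apply' _ _ _ fun ⟨b, hb⟩ => h (hb ▸ b.2)
  simp [constantVec, this]

theorem linearMap_pi_apply_eq_sum {S M : Type*} [CommSemiring S] [AddCommMonoid M] [Module S M]
    (φ : (Fin r → S) →ₗ[S] M) (Z : Fin r → S) : φ Z = ∑ a, Z a • φ (Pi.single a 1) := by
  conv_lhs => rw [pi_eq_sum_univ' Z, map_sum]
  simp only [map_smul]

variable {s : ℕ} {φ : (Fin r → MvPolynomial ι k) →ₗ[MvPolynomial ι k] MvPolynomial ι k}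

theorem degree_add_eq_of_coeff_constantVec_ne_zero
    (hφ : ∀ a, ∀ e ∈ (φ (Pi.single a 1)).support, e.degree + s = deg a)
    (z : {a // deg a = N} → k) {e : ι →₀ ℕ} (he : coeff e (φ (constantVec deg N z)) ≠ 0) :
    e.degree + s = N := by
  rw [linearMap_pi_apply_eq_sum, coeff_sum] at he
  obtain ⟨a, -, ha⟩ := Finset.exists_ne_zero_of_sum_ne_zero he
  by_cases h : deg a = N
  · rw [constantVec_of_eq z h, smul_eq_mul, coeff_C_mul] at ha
    exact h ▸ hφ a e (mem_support_iff.2 (right_ne_zero_of_mul ha))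
  · simp [constantVec_of_ne z h] at ha

theorem coeff_constantVec_constantCoeff
    (hφ : ∀ a, ∀ e ∈ (φ (Pi.single a 1)).support, e.degree + s = deg a) {e : ι →₀ ℕ}
    (hmem : ∀ a, φ (Pi.single a 1) ∈ idealOfVars ι k ^ e.degree) (he : e.degree + s = N)
    (Z : Fin r → MvPolynomial ι k) :
    coeff e (φ (constantVec deg N fun a => constantCoeff (Z a))) = coeff e (φ Z) := by
  rw [linearMap_pi_apply_eq_sum φ Z, linearMap_pi_apply_eq_sum, coeff_sum, coeff_sum]
  refine Finset.sum_congr rfl fun a _ => ?_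
  rw [smul_eq_mul, smul_eq_mul, coeff_mul_of_mem_pow_idealOfVars (hmem a) _ le_rfl,
    coeff_mul_of_mem_pow_idealOfVars (hmem a) _ le_rfl]
  by_cases ha : deg a = N
  · rw [constantVec_of_eq _ ha, constantCoeff_C]
  · rw [notMem_support_iff.1 fun hmem => ha ((hφ a e hmem).symm.trans he), mul_zero, mul_zero]

end ConstantVectors

namespace MinimalGradedFreeResolution

variable {k ι : Type*} [Field k] {I : Ideal (MvPolynomial ι k)}
  (F : MinimalGradedFreeResolution I) {n i : ℕ}

theorem aug_mem (Z : Fin (F.rank 0) → MvPolynomial ι k) : F.aug Z ∈ I :=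
  F.range_aug.le (LinearMap.mem_range_self _ _)

theorem aug_d (Z : Fin (F.rank 1) → MvPolynomial ι k) : F.aug (F.d 0 Z) = 0 :=
  F.exact_aug.apply_apply_eq_zero Z

theorem d_d (i : ℕ) (Z : Fin (F.rank (i + 2)) → MvPolynomial ι k) :
    F.d i (F.d (i + 1) Z) = 0 :=
  (F.exact_d i).apply_apply_eq_zero Z

theorem d_mem_idealOfVars (i : ℕ) (Z : Fin (F.rank (i + 1)) → MvPolynomial ι k)
    (b : Fin (F.rank i)) : F.d i Z b ∈ idealOfVars ι k ^ 1 := by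
  refine (mem_pow_idealOfVars_iff' 1 _).2 fun e he => ?_
  obtain rfl := (Finsupp.degree_eq_zero_iff e).1 (Nat.lt_one_iff.1 he)
  exact F.minimal i Z b

theorem d_ne_single (i : ℕ) (a : Fin (F.rank i)) (Z : Fin (F.rank (i + 1)) → MvPolynomial ι k) :
    F.d i Z ≠ Pi.single a 1 := fun h => by
  simpa [h] using F.minimal i Z a

theorem add_le_deg (hI : I ≤ idealOfVars ι k ^ n) (i : ℕ) (a : Fin (F.rank i)) :
    n + i ≤ F.deg i a := by
  induction i with
  | zero =>
    by_contra! hlt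
    have haug : F.aug (Pi.single a 1) = 0 := by
      ext e
      by_cases he : e.degree = F.deg 0 a
      · exact (mem_pow_idealOfVars_iff' n _).1 (hI (F.aug_mem _)) e (by omega)
      · rw [(F.aug_homogeneous a).coeff_eq_zero he, coeff_zero]
    obtain ⟨Z, hZ⟩ := (F.exact_aug _).1 haug
    exact F.d_ne_single 0 a Z hZ
  | succ i ih =>
    by_contra! hlt
    have hd : F.d i (Pi.single a 1) = 0 := by
      funext b
      ext e
      by_contra hne
      have hdeg := F.d_homogeneous i a b e (mem_support_iff.2 hne)
      have hone := (mem_pow_idealOfVars_iff 1 _).1 (F.d_mem_idealOfVars i _ b) e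
        (mem_support_iff.2 hne)
      have := ih b
      omega
    obtain ⟨Z, hZ⟩ := (F.exact_d i _).1 hd
    exact F.d_ne_single (i + 1) a Z hZ

/-- The degree `n + i` part of the `k`-span of the basis of `F_i`. -/
abbrev Strand (n i : ℕ) : Type _ := {a : Fin (F.rank i) // F.deg i a = n + i} → k

theorem finrank_strand (n i : ℕ) : Module.finrank k (F.Strand n i) = F.betti i (n + i) := by
  rw [Module.finrank_fintype_fun_eq_card, Fintype.card_subtype, betti]

/-- The inclusion of the linear strand into the resolution. -/
noncomputable abbrev ofStrand (n i : ℕ) :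
    F.Strand n i →ₗ[k] (Fin (F.rank i) → MvPolynomial ι k) :=
  constantVec (F.deg i) (n + i)

/-- The coefficient of the variable `w` in the differential of the linear strand. -/
noncomputable def strandD (n i : ℕ) (w : ι) : F.Strand n (i + 1) →ₗ[k] F.Strand n i :=
  LinearMap.pi fun b => lcoeff k (Finsupp.single w 1) ∘ₗ LinearMap.proj b.1 ∘ₗ
    (F.d i).restrictScalars k ∘ₗ F.ofStrand n (i + 1)

theorem strandD_apply (w : ι) (z : F.Strand n (i + 1))
    (b : {a : Fin (F.rank i) // F.deg i a = n + i}) :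
    F.strandD n i w z b = coeff (Finsupp.single w 1) (F.d i (F.ofStrand n (i + 1) z) b) := rfl

theorem eq_zero_of_d_eq_ofStrand {z : F.Strand n i} (h : ∃ Z, F.d i Z = F.ofStrand n i z) :
    z = 0 := by
  obtain ⟨Z, hZ⟩ := h
  funext a
  simpa [hZ, constantVec_of_eq z a.2] using F.minimal i Z a.1

theorem aug_ofStrand_mem (z : F.Strand n 0) : F.aug (F.ofStrand n 0 z) ∈ homogeneousPart I n := by
  refine ⟨F.aug_mem _, isHomogeneous_iff_degree_eq.2 fun e he => ?_⟩
  exact degree_add_eq_of_coeff_constantVec_ne_zero (s := 0)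
    (fun a => isHomogeneous_iff_degree_eq.1 (F.aug_homogeneous a)) z (mem_support_iff.1 he)

theorem eq_zero_of_aug_ofStrand_eq_zero {z : F.Strand n 0} (h : F.aug (F.ofStrand n 0 z) = 0) :
    z = 0 :=
  F.eq_zero_of_d_eq_ofStrand ((F.exact_aug _).1 h)

theorem exists_aug_ofStrand_eq (hI : I ≤ idealOfVars ι k ^ n) {p : MvPolynomial ι k}
    (hp : p ∈ homogeneousPart I n) : ∃ z : F.Strand n 0, F.aug (F.ofStrand n 0 z) = p := by
  obtain ⟨hpI, hp⟩ := hp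
  obtain ⟨Z, rfl⟩ := F.range_aug.ge hpI
  refine ⟨fun a => constantCoeff (Z a), ?_⟩
  ext e
  by_cases he : e.degree = n
  · exact coeff_constantVec_constantCoeff (s := 0)
      (fun a => isHomogeneous_iff_degree_eq.1 (F.aug_homogeneous a))
      (fun a => he ▸ hI (F.aug_mem _)) he Z
  · rw [IsHomogeneous.coeff_eq_zero hp he,
      IsHomogeneous.coeff_eq_zero (F.aug_ofStrand_mem _).2 he]

/-- The Koszul cycle of an element of the linear strand. -/
noncomputable def toKoszul (n : ℕ) :
    ∀ i, F.Strand n i →ₗ[k] ((Fin i → ι) → MvPolynomial ι k)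
  | 0 => LinearMap.pi fun _ => F.aug.restrictScalars k ∘ₗ F.ofStrand n 0
  | i + 1 => LinearMap.pi fun v =>
      LinearMap.proj (Fin.tail v) ∘ₗ toKoszul n i ∘ₗ F.strandD n i (v 0)

theorem toKoszul_zero (z : F.Strand n 0) (v : Fin 0 → ι) :
    F.toKoszul n 0 z v = F.aug (F.ofStrand n 0 z) := rfl

theorem toKoszul_cons (z : F.Strand n (i + 1)) (w : ι) (v : Fin i → ι) :
    F.toKoszul n (i + 1) z (Fin.cons w v) = F.toKoszul n i (F.strandD n i w z) v := rfl

theorem d_ofStrand [Fintype ι] (hI : I ≤ idealOfVars ι k ^ n) (z : F.Strand n (i + 1)) :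
    F.d i (F.ofStrand n (i + 1) z) =
      ∑ w, (X w : MvPolynomial ι k) • F.ofStrand n i (F.strandD n i w z) := by
  funext b
  have degree_add_deg : ∀ e ∈ (F.d i (F.ofStrand n (i + 1) z) b).support,
      e.degree + F.deg i b = n + (i + 1) := fun e he =>
    degree_add_eq_of_coeff_constantVec_ne_zero (φ := LinearMap.proj b ∘ₗ F.d i)
      (fun a => F.d_homogeneous i a b) z (mem_support_iff.1 he)
  simp only [Finset.sum_apply, Pi.smul_apply, smul_eq_mul]
  by_cases h : F.deg i b = n + i
  · simp only [constantVec_of_eq _ h, strandD_apply]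
    refine eq_sum_X_mul_C_of_isHomogeneous_one (isHomogeneous_iff_degree_eq.2 fun e he => ?_)
    have := degree_add_deg e he
    omega
  · simp only [constantVec_of_ne _ h, mul_zero, Finset.sum_const_zero]
    refine support_eq_empty.1 (Finset.eq_empty_of_forall_notMem fun e he => ?_)
    have := degree_add_deg e he
    have := (mem_pow_idealOfVars_iff 1 _).1 (F.d_mem_idealOfVars i _ b) e he
    have := F.add_le_deg hI i b
    omega

theorem eq_zero_of_strandD_eq_zero [Finite ι] (hI : I ≤ idealOfVars ι k ^ n)
    {z : F.Strand n (i + 1)} (h : ∀ w, F.strandD n i w z = 0) : z = 0 := by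
  have := Fintype.ofFinite ι
  exact F.eq_zero_of_d_eq_ofStrand ((F.exact_d i _).1 (by simp [F.d_ofStrand hI, h]))

theorem strandD_strandD [Finite ι] (hI : I ≤ idealOfVars ι k ^ n) (z : F.Strand n (i + 2)) :
    (∀ v, F.strandD n i v (F.strandD n (i + 1) v z) = 0) ∧
      ∀ v w, v ≠ w → F.strandD n i w (F.strandD n (i + 1) v z) =
        -F.strandD n i v (F.strandD n (i + 1) w z) := by
  have := Fintype.ofFinite ι
  have hdd := F.d_d i (F.ofStrand n (i + 2) z)
  simp only [F.d_ofStrand hI, map_sum, map_smul] at hdd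
  have antisymm : ∀ b : {a : Fin (F.rank i) // F.deg i a = n + i}, _ := fun b =>
    apply_self_eq_zero_and_antisymm_of_sum_X_mul_X_eq_zero
      (fun v w => F.strandD n i w (F.strandD n (i + 1) v z) b) (by
        simpa only [Finset.sum_apply, Pi.smul_apply, smul_eq_mul, constantVec_of_eq _ b.2,
          Pi.zero_apply] using congrFun hdd b.1)
  exact ⟨fun v => funext fun b => (antisymm b).1 v,
    fun v w hvw => funext fun b => (antisymm b).2 v w hvw⟩

theorem exists_strandD_eq_of_exists_d_eq [Fintype ι] (y : ι → F.Strand n i)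
    (h : ∃ Z, F.d i Z = ∑ w, (X w : MvPolynomial ι k) • F.ofStrand n i (y w)) :
    ∃ z : F.Strand n (i + 1), ∀ w, F.strandD n i w z = y w := by
  obtain ⟨Z, hZ⟩ := h
  refine ⟨fun a => constantCoeff (Z a), fun w => funext fun b => ?_⟩
  have hcoeff := coeff_constantVec_constantCoeff (φ := LinearMap.proj b.1 ∘ₗ F.d i)
    (e := Finsupp.single w 1) (N := n + (i + 1)) (fun a => F.d_homogeneous i a b.1)
    (fun a => by simpa using F.d_mem_idealOfVars i _ b.1) (by simp [b.2]; omega) Z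
  rw [strandD_apply]
  refine hcoeff.trans ?_
  simpa only [LinearMap.comp_apply, LinearMap.proj_apply, Finset.sum_apply, Pi.smul_apply,
    smul_eq_mul, constantVec_of_eq _ b.2, coeff_single_sum_X_mul_C fun w => y w b] using
    congrArg (coeff (Finsupp.single w 1)) (congrFun hZ b.1)

theorem exists_strandD_eq [Finite ι] (hI : I ≤ idealOfVars ι k ^ n)
    (y : ι → F.Strand n (i + 1)) (hself : ∀ v, F.strandD n i v (y v) = 0)
    (hswap : ∀ v w, v ≠ w → F.strandD n i w (y v) = -F.strandD n i v (y w)) :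
    ∃ z : F.Strand n (i + 2), ∀ w, F.strandD n (i + 1) w z = y w := by
  classical
  have := Fintype.ofFinite ι
  refine F.exists_strandD_eq_of_exists_d_eq y ((F.exact_d i _).1 ?_)
  simp only [map_sum, map_smul, F.d_ofStrand hI, Finset.smul_sum]
  rw [← Finset.sum_product', Finset.univ_product_univ]
  refine Finset.sum_involution (fun p _ => p.swap) ?_ ?_ (fun _ _ => Finset.mem_univ _)
    (fun _ _ => Prod.swap_swap _)
  · rintro ⟨v, w⟩ -
    rcases eq_or_ne v w with rfl | hvw
    · simp [hself]
    · simp [hswap v w hvw, smul_comm (X v : MvPolynomial ι k) (X w)]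
  · rintro ⟨v, w⟩ - hne heq
    obtain rfl : w = v := congrArg Prod.fst heq
    simp [hself] at hne

theorem toKoszul_injective [Finite ι] (hI : I ≤ idealOfVars ι k ^ n) (i : ℕ) :
    Function.Injective (F.toKoszul n i) := by
  rw [injective_iff_map_eq_zero]
  induction i with
  | zero => exact fun z hz => F.eq_zero_of_aug_ofStrand_eq_zero (congrFun hz Fin.elim0)
  | succ i ih =>
    exact fun z hz => F.eq_zero_of_strandD_eq_zero hI fun w =>
      ih _ (funext fun v => congrFun hz (Fin.cons w v))

variable [Fintype ι]

theorem sum_X_mul_toKoszul_one (hI : I ≤ idealOfVars ι k ^ n) (z : F.Strand n 1) :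
    ∑ w, X w * F.toKoszul n 1 z (fun _ => w) = 0 := by
  have h := F.aug_d (F.ofStrand n 1 z)
  simp only [F.d_ofStrand hI, map_sum, map_smul, smul_eq_mul] at h
  exact h

theorem toKoszul_mem (hI : I ≤ idealOfVars ι k ^ n) :
    ∀ (i : ℕ) (z : F.Strand n i), F.toKoszul n i z ∈ koszulCycles (homogeneousPart I n) i
  | 0, z => by
    refine ⟨fun _ => F.aug_ofStrand_mem z,
      ⟨fun v hv => absurd (Function.injective_of_subsingleton v) hv, fun v π => ?_⟩,
      fun _ j => j.elim0⟩
    simp [Subsingleton.elim π 1]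
  | 1, z => by
    refine ⟨fun _ => F.aug_ofStrand_mem _,
      ⟨fun v hv => absurd (Function.injective_of_subsingleton v) hv, fun v π => ?_⟩,
      fun v j => ?_⟩
    · simp [Subsingleton.elim π 1]
    · simp only [Function.update_eq_const_of_subsingleton]
      exact F.sum_X_mul_toKoszul_one hI z
  | i + 2, z => by
    obtain ⟨hself, hswap⟩ := F.strandD_strandD hI z
    refine koszulCycles_of_cons (fun w => toKoszul_mem hI (i + 1) (F.strandD n (i + 1) w z))
      (fun x v => ?_) fun x y v hxy => ?_
    · simp [toKoszul_cons, hself]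
    · simp [toKoszul_cons, hswap x y hxy]

theorem exists_toKoszul_eq (hI : I ≤ idealOfVars ι k ^ n) :
    ∀ (i : ℕ) {c : (Fin i → ι) → MvPolynomial ι k},
      c ∈ koszulCycles (homogeneousPart I n) i → ∃ z, F.toKoszul n i z = c
  | 0, c, hc => by
    obtain ⟨z, hz⟩ := F.exists_aug_ofStrand_eq hI (hc.1 Fin.elim0)
    exact ⟨z, funext fun v => by rw [toKoszul_zero, hz, Subsingleton.elim v]⟩
  | i + 1, c, hc => by
    choose y hy using fun w => exists_toKoszul_eq hI i (koszulCycles_cons hc w)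
    have hy' : ∀ w v, F.toKoszul n i (y w) v = c (Fin.cons w v) := fun w v => congrFun (hy w) v
    suffices ∃ z : F.Strand n (i + 1), ∀ w, F.strandD n i w z = y w by
      obtain ⟨z, hz⟩ := this
      refine ⟨z, funext fun v => ?_⟩
      rw [← Fin.cons_self_tail v, toKoszul_cons, hz, hy']
    cases i with
    | zero =>
      refine F.exists_strandD_eq_of_exists_d_eq y ((F.exact_aug _).1 ?_)
      have hconst : ∀ w, F.aug (F.ofStrand n 0 (y w)) = c fun _ => w := fun w => by
        rw [← toKoszul_zero F (y w) Fin.elim0, hy']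
        exact congrArg c (funext fun x => by
          rw [Subsingleton.elim (α := Fin 1) x 0, Fin.cons_zero])
      simp only [map_sum, map_smul, smul_eq_mul, hconst]
      exact sum_X_mul_const_eq_zero_of_mem_koszulCycles hc
    | succ i =>
      have hinj := F.toKoszul_injective hI i
      refine F.exists_strandD_eq hI y (fun v => hinj (funext fun u => ?_))
        fun v w _ => hinj (funext fun u => ?_)
      · rw [← toKoszul_cons, hy', map_zero]
        exact hc.2.1.apply_eq_zero _ fun h => Fin.zero_ne_one (h rfl)
      · rw [← toKoszul_cons, hy', map_neg, Pi.neg_apply, ← toKoszul_cons, hy',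
          ← cons_cons_comp_swap, hc.2.1.apply_comp_swap _ Fin.zero_ne_one]

theorem betti_eq_finrank_koszulCycles (hI : I ≤ idealOfVars ι k ^ n) (i : ℕ) :
    F.betti i (n + i) = Module.finrank k (koszulCycles (homogeneousPart I n) i) := by
  rw [← F.finrank_strand n i]
  refine (LinearEquiv.ofBijective
    ((F.toKoszul n i).codRestrict _ (F.toKoszul_mem hI i)) ⟨fun z z' h => ?_, ?_⟩).finrank_eq
  · exact F.toKoszul_injective hI i (congrArg Subtype.val h)
  · rintro ⟨c, hc⟩
    obtain ⟨z, hz⟩ := F.exists_toKoszul_eq hI i hc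
    exact ⟨z, Subtype.ext hz⟩

end MinimalGradedFreeResolution

/-! ### Exponents of tuples and sets of variables -/

section Exponents

variable {ι κ κ' : Type*} [Fintype κ] [Fintype κ']

/-- The exponent of the monomial `∏ j, X (v j)`. -/
noncomputable def tupleExp (v : κ → ι) : ι →₀ ℕ :=
  ∑ j, Finsupp.single (v j) 1

/-- The exponent of the squarefree monomial `∏ x ∈ U, X x`. -/
noncomputable def setExp (U : Finset ι) : ι →₀ ℕ :=
  ∑ x ∈ U, Finsupp.single x 1

theorem prod_X_eq_monomial_tupleExp (R : Type*) [CommSemiring R] (v : κ → ι) :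
    ∏ j, (X (v j) : MvPolynomial ι R) = monomial (tupleExp v) 1 :=
  (monomial_sum_one _ _).symm

theorem tupleExp_sumElim (v : κ → ι) (w : κ' → ι) :
    tupleExp (Sum.elim v w) = tupleExp v + tupleExp w := by
  simp only [tupleExp, Fintype.sum_sum_type, Sum.elim_inl, Sum.elim_inr]

theorem tupleExp_comp_equiv (v : κ → ι) (e : κ' ≃ κ) : tupleExp (v ∘ e) = tupleExp v :=
  Equiv.sum_comp e fun j => Finsupp.single (v j) 1

theorem mapDomain_tupleExp {ι' : Type*} (g : ι → ι') (v : κ → ι) :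
    (tupleExp v).mapDomain g = tupleExp (g ∘ v) := by
  simp only [tupleExp, Finsupp.mapDomain_finsetSum, Finsupp.mapDomain_single, Function.comp_apply]

theorem degree_tupleExp (v : κ → ι) : (tupleExp v).degree = Fintype.card κ := by
  simp [tupleExp]

theorem tupleExp_update [DecidableEq κ] (v : κ → ι) (j : κ) (w : ι) :
    tupleExp (Function.update v j w) + Finsupp.single (v j) 1 =
      tupleExp v + Finsupp.single w 1 := by
  have hrest : ∑ x ∈ Finset.univ.erase j, Finsupp.single (Function.update v j w x) 1 =
      ∑ x ∈ Finset.univ.erase j, Finsupp.single (v x) (1 : ℕ) :=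
    Finset.sum_congr rfl fun x hx => by
      rw [Function.update_of_ne (Finset.ne_of_mem_erase hx)]
  rw [tupleExp, tupleExp, ← Finset.add_sum_erase _ _ (Finset.mem_univ j),
    ← Finset.add_sum_erase _ (fun j => Finsupp.single (v j) 1) (Finset.mem_univ j), hrest,
    Function.update_self]
  abel

theorem tupleExp_ne_zero_iff {v : κ → ι} {x : ι} : tupleExp v x ≠ 0 ↔ ∃ j, v j = x := by
  classical simp [tupleExp, Finsupp.single_apply]

theorem exists_perm_of_tupleExp_eq {v v' : κ → ι} (hv : Function.Injective v)
    (h : tupleExp v' = tupleExp v) : ∃ π : Equiv.Perm κ, v' = v ∘ π := by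
  have hrange (x : ι) : (∃ j, v' j = x) ↔ ∃ j, v j = x := by
    rw [← tupleExp_ne_zero_iff, h, tupleExp_ne_zero_iff]
  choose f hf using fun j => (hrange (v' j)).1 ⟨j, rfl⟩
  have hsurj : Function.Surjective f := fun l => by
    obtain ⟨j, hj⟩ := (hrange (v l)).2 ⟨l, rfl⟩
    exact ⟨j, hv ((hf j).trans hj)⟩
  exact ⟨Equiv.ofBijective f (Finite.surjective_iff_bijective.1 hsurj),
    funext fun j => (hf j).symm⟩

theorem setExp_apply [DecidableEq ι] (U : Finset ι) (x : ι) :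
    setExp U x = if x ∈ U then 1 else 0 := by
  simp only [setExp, Finsupp.finsetSum_apply, Finsupp.single_apply]
  exact Finset.sum_ite_eq' U x fun _ => 1

theorem setExp_injective : Function.Injective (setExp : Finset ι → ι →₀ ℕ) := by
  classical
  intro U V h
  ext x
  have hx := DFunLike.congr_fun h x
  rw [setExp_apply, setExp_apply] at hx
  by_cases hU : x ∈ U <;> by_cases hV : x ∈ V <;> simp_all

theorem tupleExp_eq_setExp [DecidableEq ι] {v : κ → ι} (hv : Function.Injective v) :
    tupleExp v = setExp (Finset.univ.image v) := by
  rw [setExp, Finset.sum_image hv.injOn, tupleExp]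

end Exponents

/-! ### Diagonal monomials -/

section Diagonals

variable {α β : Type*}

/-- The row of a position in a matrix whose positions are ordered lexicographically. -/
def row (x : α ×ₗ β) : α := (ofLex x).1

/-- The column of a position in a matrix whose positions are ordered lexicographically. -/
def col (x : α ×ₗ β) : β := (ofLex x).2

theorem eq_of_row_eq_of_col_eq {x y : α ×ₗ β} (hrow : row x = row y) (hcol : col x = col y) :
    x = y :=
  ofLex.injective (Prod.ext hrow hcol)

/-- The positions of the entries of the diagonal term of the maximal minor on the columns `s r`,
one in each row `r`. -/
def diag (s : α → β) (r : α) : α ×ₗ β := toLex (r, s r)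

theorem diag_injective (s : α → β) : Function.Injective (diag s) :=
  fun _ _ h => congrArg row h

theorem diag_update [DecidableEq α] (s : α → β) (r : α) (a : β) :
    diag (Function.update s r a) = Function.update (diag s) r (toLex (r, a)) := by
  funext q
  rcases eq_or_ne q r with rfl | h
  · simp only [diag, Function.update_self]
  · simp only [diag, Function.update_of_ne h]

variable [Fintype α]

theorem tupleExp_diag_ne_zero_iff {s : α → β} {x : α ×ₗ β} :
    tupleExp (diag s) x ≠ 0 ↔ s (row x) = col x := by
  rw [tupleExp_ne_zero_iff]
  constructor
  · rintro ⟨r, rfl⟩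
    rfl
  · exact fun h => ⟨row x, eq_of_row_eq_of_col_eq rfl h⟩

theorem tupleExp_diag_injective : Function.Injective fun s : α → β => tupleExp (diag s) := by
  intro s t h
  funext r
  have hr : tupleExp (diag t) (diag s r) ≠ 0 := by
    rw [← show tupleExp (diag s) = tupleExp (diag t) from h]
    exact tupleExp_diag_ne_zero_iff.2 rfl
  exact (tupleExp_diag_ne_zero_iff.1 hr).symm

theorem exchange_diag [DecidableEq α] {s s' : α → β} {x w : α ×ₗ β} (hw : w ≠ x)
    (h : Finsupp.single w 1 + tupleExp (diag s') = Finsupp.single x 1 + tupleExp (diag s)) :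
    col x ≠ s (row x) ∧ s' = Function.update s (row x) (col x) := by
  classical
  have hrow : row w = row x := by
    have hmap := congrArg (Finsupp.mapDomain row) h
    simp only [Finsupp.mapDomain_add, Finsupp.mapDomain_single, mapDomain_tupleExp] at hmap
    exact Finsupp.single_left_injective one_ne_zero (add_right_cancel hmap)
  have hx : s' (row x) = col x := by
    have hx := DFunLike.congr_fun h x
    simp only [Finsupp.add_apply, Finsupp.single_apply, if_neg hw, if_true] at hx
    exact tupleExp_diag_ne_zero_iff.1 (by omega)
  have hs' : s' = Function.update s (row x) (col x) := by
    refine Function.eq_update_iff.2 ⟨hx, fun q hq => ?_⟩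
    have hqx : x ≠ diag s' q := fun hqx => hq (congrArg row hqx).symm
    have hqw : w ≠ diag s' q := fun hqw => hq (hrow ▸ congrArg row hqw).symm
    have hs'q : tupleExp (diag s') (diag s' q) ≠ 0 := tupleExp_diag_ne_zero_iff.2 rfl
    have hq' := DFunLike.congr_fun h (diag s' q)
    simp only [Finsupp.add_apply, Finsupp.single_apply, if_neg hqx, if_neg hqw] at hq'
    have hsq : tupleExp (diag s) (diag s' q) ≠ 0 := by omega
    exact (tupleExp_diag_ne_zero_iff.1 hsq).symm
  refine ⟨fun hcol => hw ?_, hs'⟩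
  rw [hs', hcol, Function.update_eq_self] at h
  exact Finsupp.single_left_injective one_ne_zero (add_right_cancel h)

end Diagonals

/-! ### Staircases -/

section Staircases

variable {α β : Type*} [LinearOrder α] [LinearOrder β]

/-- A set of positions is a staircase if its columns strictly increase from one row to any later
row. -/
def IsStaircase (U : Finset (α ×ₗ β)) : Prop :=
  ∀ x ∈ U, ∀ y ∈ U, row x < row y → col x < col y

theorem exists_lt_of_mapDomain_eq {ι ι' : Type*} {φ : ι → ι'} {f g : ι →₀ ℕ}
    (h : f.mapDomain φ = g.mapDomain φ) {x : ι} (hx : g x < f x) :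
    ∃ y, φ y = φ x ∧ f y < g y := by
  classical
  by_contra! hle
  have hsum (f' : ι →₀ ℕ) (hf' : f'.support ⊆ f.support ∪ g.support) :
      f'.mapDomain φ (φ x) = ∑ y ∈ f.support ∪ g.support with φ y = φ x, f' y := by
    simp only [Finsupp.mapDomain, Finsupp.sum_apply, Finsupp.single_apply]
    rw [Finsupp.sum_of_support_subset _ hf' _ (by simp), Finset.sum_filter]
  have hfg := DFunLike.congr_fun h (φ x)
  rw [hsum f Finset.subset_union_left, hsum g Finset.subset_union_right] at hfg
  refine hfg.not_gt (Finset.sum_lt_sum (fun y hy => hle y (Finset.mem_filter.1 hy).2)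
    ⟨x, ?_, hx⟩)
  simp [show f x ≠ 0 by omega]

/-- A staircase fills the rows from left to right, so moving its entries within their rows and
columns can only decrease the monomial. -/
theorem IsStaircase.lex_le_setExp [WellFoundedGT (α ×ₗ β)] {U : Finset (α ×ₗ β)}
    (hU : IsStaircase U) {f : (α ×ₗ β) →₀ ℕ}
    (hrow : f.mapDomain row = (setExp U).mapDomain row)
    (hcol : f.mapDomain col = (setExp U).mapDomain col) :
    MonomialOrder.lex.toSyn f ≤ MonomialOrder.lex.toSyn (setExp U) := by
  by_contra! hlt
  rw [MonomialOrder.lex_lt_iff, Finsupp.Lex.lt_iff] at hlt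
  obtain ⟨x, heq, hx⟩ := hlt
  simp only [ofLex_toLex] at heq hx
  have mem_and_lt {y : α ×ₗ β} (hy : f y < setExp U y) : y ∈ U ∧ x < y := by
    refine ⟨by by_contra hyU; simp [setExp_apply, hyU] at hy, ?_⟩
    by_contra! hyx
    rcases hyx.lt_or_eq with hyx | rfl
    · exact hy.ne' (heq y hyx)
    · exact hx.asymm hy
  obtain ⟨y, hyx, hy⟩ := exists_lt_of_mapDomain_eq hcol hx
  obtain ⟨z, hzx, hz⟩ := exists_lt_of_mapDomain_eq hrow hx
  have hxy : row x < row y :=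
    (Prod.Lex.lt_iff.1 (mem_and_lt hy).2).resolve_right fun h => h.2.ne' hyx
  have hxz : col x < col z :=
    ((Prod.Lex.lt_iff.1 (mem_and_lt hz).2).resolve_left fun h => h.ne' hzx).2
  have hzy := hU z (mem_and_lt hz).1 y (mem_and_lt hy).1 (hzx ▸ hxy)
  exact (hzy.trans_eq hyx).asymm hxz

theorem isStaircase_image_diag [Fintype α] {s : α → β} (hs : StrictMono s) :
    IsStaircase (Finset.univ.image (diag s)) := by
  simp only [IsStaircase, Finset.mem_image, Finset.mem_univ, true_and]
  rintro _ ⟨r, rfl⟩ _ ⟨q, rfl⟩ hrq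
  exact hs hrq

theorem lex_tupleExp_diag_comp_perm_le [Fintype α] [WellFoundedGT (α ×ₗ β)] {s : α → β}
    (hs : StrictMono s) (π : Equiv.Perm α) :
    MonomialOrder.lex.toSyn (tupleExp (diag (s ∘ π))) ≤
      MonomialOrder.lex.toSyn (tupleExp (diag s)) := by
  have hset := tupleExp_eq_setExp (diag_injective s)
  rw [hset]
  refine (isStaircase_image_diag hs).lex_le_setExp ?_ ?_
  · rw [← hset, mapDomain_tupleExp, mapDomain_tupleExp]
    rfl
  · rw [← hset, mapDomain_tupleExp, mapDomain_tupleExp]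
    exact tupleExp_comp_equiv s π

end Staircases

/-! ### Simplicial complexes and block sets -/

section Complexes

variable {n m : ℕ} {Δ : PreAbstractSimplicialComplex (Fin m)}

theorem IsPureCard.card_le (hΔ : IsPureCard n Δ) {σ : Finset (Fin m)} (hσ : σ ∈ Δ) :
    σ.card ≤ n := by
  obtain ⟨τ, hστ, hτ⟩ := (Set.toFinite {τ | τ ∈ Δ}).exists_le_maximal hσ
  exact (Finset.card_le_card hστ).trans_eq (hΔ τ hτ)

theorem isFacet_of_card_le {σ : Finset (Fin m)} (hσ : σ ∈ Δ)
    (hmax : ∀ τ ∈ Δ, τ.card ≤ σ.card) : IsFacet Δ σ :=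
  ⟨hσ, fun τ hτ hστ => (Finset.eq_of_subset_of_card_le hστ (hmax τ hτ)).ge⟩

theorem mem_cliqueComplex_of_card_eq {σ : Finset (Fin m)} (hσ : σ ∈ Δ) (hcard : σ.card = n) :
    σ ∈ cliqueComplex n Δ :=
  ⟨(Δ.isRelLowerSet_faces hσ).1, fun _ hτ hτcard =>
    (Finset.eq_of_subset_of_card_le hτ (hcard.trans hτcard.symm).le).symm ▸ hσ⟩

theorem isINonface_one_of_consecutive {σ : Finset (Fin m)} (hσ : σ ∉ Δ) {a b : Fin m}
    (ha : a ∈ σ) (hb : b ∈ σ) (hab : a < b) (hnext : ∀ x ∈ σ, a < x → b ≤ x)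
    (hσa : σ.erase a ∈ Δ) (hσb : σ.erase b ∈ Δ) : IsINonface Δ 1 σ := by
  obtain ⟨j, rfl⟩ : a ∈ Set.range (σ.orderEmbOfFin rfl) := by
    rwa [Finset.range_orderEmbOfFin, Finset.mem_coe]
  obtain ⟨l, rfl⟩ : b ∈ Set.range (σ.orderEmbOfFin rfl) := by
    rwa [Finset.range_orderEmbOfFin, Finset.mem_coe]
  have hjl : j < l := (σ.orderEmbOfFin rfl).lt_iff_lt.1 hab
  have hj : j.1 + 1 < σ.card := lt_of_le_of_lt hjl l.2
  have hl : l = ⟨j.1 + 1, hj⟩ := le_antisymm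
    ((σ.orderEmbOfFin rfl).le_iff_le.1 <| hnext _ (σ.orderEmbOfFin_mem rfl _) <|
      (σ.orderEmbOfFin rfl).lt_iff_lt.2 (Nat.lt_succ_self j.1)) hjl
  refine ⟨hσ, j, hj, fun k hk => ?_⟩
  interval_cases k
  · exact hσa
  · exact hl ▸ hσb

theorem mem_cliqueComplex_of_erase_mem
    (hnonface : ∀ σ : Finset (Fin m), σ.card = n + 1 → ¬ IsINonface (cliqueComplex n Δ) 1 σ)
    {σ : Finset (Fin m)} (hcard : n < σ.card) {a b : Fin m} (hab : a < b)
    (hnext : ∀ x ∈ σ, a < x → b ≤ x) (hσa : σ.erase a ∈ cliqueComplex n Δ)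
    (hσb : σ.erase b ∈ cliqueComplex n Δ) : σ ∈ cliqueComplex n Δ := by
  refine ⟨hσa.1.mono (Finset.erase_subset _ _), fun ρ hρσ hρ => ?_⟩
  by_cases ha : a ∈ ρ
  swap
  · exact hσa.2 ρ (Finset.subset_erase.2 ⟨hρσ, ha⟩) hρ
  by_cases hb : b ∈ ρ
  swap
  · exact hσb.2 ρ (Finset.subset_erase.2 ⟨hρσ, hb⟩) hρ
  obtain ⟨c, hcσ, hcρ⟩ := Finset.exists_mem_notMem_of_card_lt_card (hρ.trans_lt hcard)
  have hsub : insert c ρ ⊆ σ := Finset.insert_subset hcσ hρσ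
  have ha' := Finset.mem_insert_of_mem ha (b := c)
  have hb' := Finset.mem_insert_of_mem hb (b := c)
  have hmem : insert c ρ ∈ cliqueComplex n Δ := by
    by_contra hnot
    refine hnonface _ (by rw [Finset.card_insert_of_notMem hcρ, hρ]) <|
      isINonface_one_of_consecutive hnot ha' hb' hab (fun x hx => hnext x (hsub hx)) ?_ ?_
    · exact ((cliqueComplex n Δ).isRelLowerSet_faces hσa).2 (Finset.erase_subset_erase a hsub)
        ⟨b, Finset.mem_erase.2 ⟨hab.ne', hb'⟩⟩
    · exact ((cliqueComplex n Δ).isRelLowerSet_faces hσb).2 (Finset.erase_subset_erase b hsub)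
        ⟨a, Finset.mem_erase.2 ⟨hab.ne, ha'⟩⟩
  exact hmem.2 ρ (Finset.subset_insert c ρ) hρ

end Complexes

section BlockSets

/-- The columns that meet a set of positions. -/
def columns {α β : Type*} [DecidableEq β] (U : Finset (α ×ₗ β)) : Finset β := U.image col

theorem IsStaircase.strictMonoOn_col {α β : Type*} [LinearOrder α] [LinearOrder β]
    {U : Finset (α ×ₗ β)} (hU : IsStaircase U) : StrictMonoOn col (U : Set (α ×ₗ β)) :=
  fun x hx y hy hxy => (Prod.Lex.lt_iff.1 hxy).elim (hU x hx y hy) And.right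

theorem IsStaircase.columns_erase {α β : Type*} [LinearOrder α] [LinearOrder β]
    {U : Finset (α ×ₗ β)} (hU : IsStaircase U) {x : α ×ₗ β} (hx : x ∈ U) :
    columns (U.erase x) = (columns U).erase (col x) := by
  rw [columns, columns, Finset.erase_eq, Finset.erase_eq,
    Finset.image_sdiff_of_injOn hU.strictMonoOn_col.injOn (Finset.singleton_subset_iff.2 hx),
    Finset.image_singleton]

variable {n m i : ℕ} {Δ : PreAbstractSimplicialComplex (Fin m)} {U : Finset (Fin n ×ₗ Fin m)}

/-- A transversal of a set of positions: it contains one position in each row. -/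
def IsTransversal {α β : Type*} (U : Finset (α ×ₗ β)) (s : α → β) : Prop :=
  ∀ r, diag s r ∈ U

theorem IsTransversal.update {α β : Type*} [DecidableEq α] {U : Finset (α ×ₗ β)} {s : α → β}
    (hs : IsTransversal U s) {x : α ×ₗ β} (hx : x ∈ U) :
    IsTransversal U (Function.update s (row x) (col x)) := by
  intro r
  rw [diag_update]
  rcases eq_or_ne r (row x) with rfl | hr
  · rwa [Function.update_self]
  · rw [Function.update_of_ne hr]
    exact hs r

theorem IsTransversal.update_erase {α β : Type*} [DecidableEq α] [DecidableEq (α ×ₗ β)]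
    {U : Finset (α ×ₗ β)} {s : α → β} (hs : IsTransversal U s) {x y : α ×ₗ β} (hy : y ∈ U)
    (hrow : row x = row y) (hne : y ≠ x) :
    IsTransversal (U.erase x) (Function.update s (row y) (col y)) := by
  refine fun r => Finset.mem_erase.2 ⟨fun h => hne ?_, hs.update hy r⟩
  obtain rfl : r = row y := (congrArg row h).trans hrow
  rw [← h, diag, Function.update_self]
  rfl

theorem IsTransversal.card_le {α β : Type*} [Fintype α] {U : Finset (α ×ₗ β)} {s : α → β}
    (hs : IsTransversal U s) : Fintype.card α ≤ U.card := by
  rw [← Finset.card_univ]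
  exact Finset.card_le_card_of_injOn _ (fun r _ => hs r) (diag_injective s).injOn

theorem isStaircase_of_forall_isTransversal {α β : Type*} [LinearOrder α] [LinearOrder β]
    {U : Finset (α ×ₗ β)} {s : α → β} (hs : IsTransversal U s)
    (hmono : ∀ t, IsTransversal U t → StrictMono t) : IsStaircase U := by
  intro x hx y hy hxy
  have h := hmono _ ((hs.update hx).update hy) hxy
  rwa [Function.update_self, Function.update_of_ne hxy.ne, Function.update_self] at h

/-- `s_1 < ⋯ < s_n` are the vertices of a face of `Δ`. -/
def IsFaceTuple (Δ : PreAbstractSimplicialComplex (Fin m)) (s : Fin n → Fin m) : Prop :=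
  StrictMono s ∧ Finset.univ.image s ∈ Δ

theorem columns_mem_cliqueComplex_of_injOn_row {s : Fin n → Fin m} (hs : IsTransversal U s)
    (hsΔ : IsFaceTuple Δ s) (hU : Set.InjOn row (U : Set (Fin n ×ₗ Fin m))) :
    columns U ∈ cliqueComplex n Δ := by
  have hcol : columns U = Finset.univ.image s := by
    ext a
    simp only [columns, Finset.mem_image, Finset.mem_univ, true_and]
    constructor
    · rintro ⟨x, hx, rfl⟩
      exact ⟨row x, congrArg col (hU (hs (row x)) hx rfl)⟩
    · rintro ⟨r, rfl⟩
      exact ⟨diag s r, hs r, rfl⟩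
  rw [hcol]
  refine mem_cliqueComplex_of_card_eq hsΔ.2 ?_
  rw [Finset.card_image_of_injective _ hsΔ.1.injective, Finset.card_univ, Fintype.card_fin]

theorem exists_consecutive_of_not_injOn_row {α β : Type*} [LinearOrder α] [LinearOrder β]
    {U : Finset (α ×ₗ β)} (hU : ¬ Set.InjOn row (U : Set (α ×ₗ β))) :
    ∃ x ∈ U, ∃ y ∈ U, row x = row y ∧ x < y ∧ ∀ z ∈ U, x < z → y ≤ z := by
  obtain ⟨x, hx, y, hy, hrow, hxy⟩ : ∃ x ∈ U, ∃ y ∈ U, row x = row y ∧ x < y := by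
    simp only [Set.InjOn, not_forall] at hU
    obtain ⟨x, hx, y, hy, hrow, hne⟩ := hU
    rcases lt_or_gt_of_ne hne with h | h
    exacts [⟨x, hx, y, hy, hrow, h⟩, ⟨y, hy, x, hx, hrow.symm, h⟩]
  have hne : (U.filter (x < ·)).Nonempty := ⟨y, Finset.mem_filter.2 ⟨hy, hxy⟩⟩
  obtain ⟨hzU, hxz⟩ := Finset.mem_filter.1 (Finset.min'_mem _ hne)
  refine ⟨x, hx, _, hzU, ?_, hxz, fun w hw hxw =>
    Finset.min'_le _ _ (Finset.mem_filter.2 ⟨hw, hxw⟩)⟩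
  have hzy := Finset.min'_le _ _ (Finset.mem_filter.2 ⟨hy, hxy⟩)
  exact le_antisymm (Prod.Lex.monotone_fst _ _ hxz.le)
    ((Prod.Lex.monotone_fst _ _ hzy).trans_eq hrow.symm)

theorem columns_mem_cliqueComplex
    (hnonface : ∀ σ : Finset (Fin m), σ.card = n + 1 → ¬ IsINonface (cliqueComplex n Δ) 1 σ)
    {s : Fin n → Fin m} (hs : IsTransversal U s)
    (hΔ : ∀ t, IsTransversal U t → IsFaceTuple Δ t) : columns U ∈ cliqueComplex n Δ := by
  induction U using Finset.strongInduction generalizing s with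
  | H U ih =>
  by_cases hrow : Set.InjOn row (U : Set (Fin n ×ₗ Fin m))
  · exact columns_mem_cliqueComplex_of_injOn_row hs (hΔ s hs) hrow
  have hU : IsStaircase U := isStaircase_of_forall_isTransversal hs fun t ht => (hΔ t ht).1
  obtain ⟨x, hx, y, hy, hxy, hlt, hnext⟩ : ∃ x ∈ U, ∃ y ∈ U, row x = row y ∧ x < y ∧
      ∀ z ∈ U, x < z → y ≤ z := exists_consecutive_of_not_injOn_row hrow
  have herase {z w : Fin n ×ₗ Fin m} (hz : z ∈ U) (hw : w ∈ U) (hzw : row z = row w)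
      (hne : w ≠ z) : (columns U).erase (col z) ∈ cliqueComplex n Δ := by
    rw [← hU.columns_erase hz]
    exact ih _ (Finset.erase_ssubset hz) (hs.update_erase hw hzw hne)
      fun t ht => hΔ t fun r => Finset.mem_of_mem_erase (ht r)
  have hcard : n < (columns U).card := by
    rw [columns, Finset.card_image_of_injOn hU.strictMonoOn_col.injOn]
    refine lt_of_le_of_lt ?_ (Finset.card_erase_lt_of_mem hx)
    simpa only [Fintype.card_fin] using (hs.update_erase hy hxy hlt.ne').card_le
  refine mem_cliqueComplex_of_erase_mem hnonface hcard (hU.strictMonoOn_col hx hy hlt)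
    (fun a ha hxa => ?_) (herase hx hy hxy hlt.ne') (herase hy hx hxy.symm hlt.ne)
  obtain ⟨z, hz, rfl⟩ := Finset.mem_image.1 ha
  exact hU.strictMonoOn_col.le_iff_le hy hz |>.2
    (hnext z hz ((hU.strictMonoOn_col.lt_iff_lt hx hz).1 hxa))

/-- The sets of `n + i` positions which consist of nonempty pieces of the `n` rows, each to the
right of the preceding one, and whose columns form a clique of `Δ`. They index the linear strands
of both ideals in homological degree `i`. -/
structure IsBlockSet (Δ : PreAbstractSimplicialComplex (Fin m)) (i : ℕ)
    (U : Finset (Fin n ×ₗ Fin m)) : Prop where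
  card_eq : U.card = n + i
  exists_isTransversal : ∃ s, IsTransversal U s
  isStaircase : IsStaircase U
  columns_mem : columns U ∈ cliqueComplex n Δ

namespace IsBlockSet

/-- A chosen transversal of a block set. -/
noncomputable def transversal (hU : IsBlockSet Δ i U) : Fin n → Fin m :=
  hU.exists_isTransversal.choose

theorem isTransversal_transversal (hU : IsBlockSet Δ i U) : IsTransversal U hU.transversal :=
  hU.exists_isTransversal.choose_spec

theorem image_diag_transversal_subset (hU : IsBlockSet Δ i U) :
    Finset.univ.image (diag hU.transversal) ⊆ U :=
  Finset.image_subset_iff.2 fun r _ => hU.isTransversal_transversal r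

theorem card_sdiff_transversal (hU : IsBlockSet Δ i U) :
    (U \ Finset.univ.image (diag hU.transversal)).card = i := by
  rw [Finset.card_sdiff_of_subset hU.image_diag_transversal_subset, hU.card_eq,
    Finset.card_image_of_injective _ (diag_injective _), Finset.card_univ, Fintype.card_fin,
    Nat.add_sub_cancel_left]

/-- The tuple of positions of a block set outside its chosen transversal. -/
noncomputable def tuple (hU : IsBlockSet Δ i U) : Fin i → Fin n ×ₗ Fin m :=
  (U \ Finset.univ.image (diag hU.transversal)).orderEmbOfFin hU.card_sdiff_transversal

theorem tuple_injective (hU : IsBlockSet Δ i U) : Function.Injective hU.tuple :=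
  (Finset.orderEmbOfFin _ _).injective

theorem tupleExp_tuple_add_tupleExp_diag (hU : IsBlockSet Δ i U) :
    tupleExp hU.tuple + tupleExp (diag hU.transversal) = setExp U := by
  rw [tupleExp_eq_setExp hU.tuple_injective, tupleExp_eq_setExp (diag_injective _), tuple,
    Finset.image_orderEmbOfFin_univ]
  exact Finset.sum_sdiff hU.image_diag_transversal_subset

end IsBlockSet

end BlockSets

/-! ### The upper bound -/

section Exchange

variable {R α β : Type*} [CommRing R] [Fintype α] {i : ℕ}
  {c : (Fin i → α ×ₗ β) → MvPolynomial (α ×ₗ β) R} {u : (α ×ₗ β) →₀ ℕ}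

/-- The component of multidegree `u` of the tuple of polynomials `c`, where the index `v` counts
with the degree of `∏ j, X (v j)`, involves diagonal monomials only. -/
def IsDiagonalAt (c : (Fin i → α ×ₗ β) → MvPolynomial (α ×ₗ β) R) (u : (α ×ₗ β) →₀ ℕ) : Prop :=
  ∀ v e, tupleExp v + e = u → coeff e (c v) ≠ 0 → ∃ s, e = tupleExp (diag s)

/-- The diagonals whose monomials occur in the component of multidegree `u` of `c`. -/
def diagonalsAt (c : (Fin i → α ×ₗ β) → MvPolynomial (α ×ₗ β) R) (u : (α ×ₗ β) →₀ ℕ) :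
    Set (α → β) :=
  {s | ∃ v, tupleExp v + tupleExp (diag s) = u ∧ coeff (tupleExp (diag s)) (c v) ≠ 0}

variable [Fintype β] {P : Submodule R (MvPolynomial (α ×ₗ β) R)}

theorem exchange_diagonalsAt [DecidableEq α] (hc : c ∈ koszulCycles P i)
    (hdiag : IsDiagonalAt c u) {v : Fin i → α ×ₗ β} {s : α → β}
    (hu : tupleExp v + tupleExp (diag s) = u)
    (hs : coeff (tupleExp (diag s)) (c v) ≠ 0) (j : Fin i) :
    col (v j) ≠ s (row (v j)) ∧
      Function.update s (row (v j)) (col (v j)) ∈ diagonalsAt c u := by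
  obtain ⟨w, hw, e, he, hwe⟩ := exists_exchange_of_mem_koszulCycles hc hs j
  have hu' : tupleExp (Function.update v j w) + e = u := by
    refine add_right_cancel (b := Finsupp.single (v j) 1 + Finsupp.single w 1) ?_
    calc _ = (tupleExp (Function.update v j w) + Finsupp.single (v j) 1) +
          (Finsupp.single w 1 + e) := by abel
      _ = _ := by rw [tupleExp_update, hwe, ← hu]; abel
  obtain ⟨s', rfl⟩ := hdiag _ _ hu' he
  obtain ⟨hne, rfl⟩ := exchange_diag hw hwe
  exact ⟨hne, _, hu', he⟩

theorem update_mem_diagonalsAt [DecidableEq α] (hc : c ∈ koszulCycles P i)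
    (hdiag : IsDiagonalAt c u) {s : α → β} (hs : s ∈ diagonalsAt c u) {x : α ×ₗ β} (hx : u x ≠ 0) :
    Function.update s (row x) (col x) ∈ diagonalsAt c u := by
  obtain ⟨v, rfl, hv⟩ := hs
  by_cases hsx : tupleExp (diag s) x = 0
  · rw [Finsupp.add_apply, hsx, add_zero] at hx
    obtain ⟨j, rfl⟩ := tupleExp_ne_zero_iff.1 hx
    exact (exchange_diagonalsAt hc hdiag rfl hv j).2
  · rw [← tupleExp_diag_ne_zero_iff.1 hsx, Function.update_eq_self]
    exact ⟨v, rfl, hv⟩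

theorem mem_diagonalsAt_of_forall_ne_zero (hc : c ∈ koszulCycles P i) (hdiag : IsDiagonalAt c u)
    {s t : α → β} (hs : s ∈ diagonalsAt c u) (ht : ∀ r, u (diag t r) ≠ 0) :
    t ∈ diagonalsAt c u := by
  classical
  suffices h : ∀ A : Finset α, A.piecewise t s ∈ diagonalsAt c u by
    have huniv := h Finset.univ
    rwa [Finset.piecewise_univ] at huniv
  intro A
  induction A using Finset.induction_on with
  | empty => rwa [Finset.piecewise_empty]
  | insert r A _ ih =>
    rw [Finset.piecewise_insert]
    exact update_mem_diagonalsAt (x := diag t r) hc hdiag ih (ht r)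

theorem injective_sumElim_diag (hc : c ∈ koszulCycles P i) (hdiag : IsDiagonalAt c u)
    {v : Fin i → α ×ₗ β} {s : α → β} (hu : tupleExp v + tupleExp (diag s) = u)
    (hs : coeff (tupleExp (diag s)) (c v) ≠ 0) : Function.Injective (Sum.elim v (diag s)) := by
  classical
  refine Function.Injective.sumElim (fun a b hab => ?_) (diag_injective s) fun j r hjr => ?_
  · by_contra hne
    exact hs (by rw [hc.2.1.apply_eq_zero v fun hv => hne (hv hab), coeff_zero])
  · refine (exchange_diagonalsAt hc hdiag hu hs j).1 ?_
    rw [hjr]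
    rfl

end Exchange

section UpperBound

variable {k : Type*} [Field k] {n m i : ℕ} {Δ : PreAbstractSimplicialComplex (Fin m)}
  {P : Submodule k (PolyRing k n m)} {c : (Fin i → Fin n ×ₗ Fin m) → PolyRing k n m}
  {u : (Fin n ×ₗ Fin m) →₀ ℕ}

theorem exists_isBlockSet_setExp_eq
    (hnonface : ∀ σ : Finset (Fin m), σ.card = n + 1 → ¬ IsINonface (cliqueComplex n Δ) 1 σ)
    (hc : c ∈ koszulCycles P i) (hdiag : IsDiagonalAt c u)
    (hface : ∀ s ∈ diagonalsAt c u, IsFaceTuple Δ s) {s : Fin n → Fin m}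
    (hs : s ∈ diagonalsAt c u) : ∃ U, IsBlockSet Δ i U ∧ setExp U = u := by
  obtain ⟨v, hu, hv⟩ := hs
  have hinj := injective_sumElim_diag hc hdiag hu hv
  obtain ⟨U, hU⟩ : ∃ U, U = Finset.univ.image (Sum.elim v (diag s)) := ⟨_, rfl⟩
  have hUu : setExp U = u := by rw [hU, ← tupleExp_eq_setExp hinj, tupleExp_sumElim, hu]
  have hsU : IsTransversal U s := fun r =>
    hU ▸ Finset.mem_image.2 ⟨Sum.inr r, Finset.mem_univ _, rfl⟩
  have htU (t : Fin n → Fin m) (ht : IsTransversal U t) : IsFaceTuple Δ t :=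
    hface t <| mem_diagonalsAt_of_forall_ne_zero hc hdiag ⟨v, hu, hv⟩ fun r => by
      rw [← hUu, setExp_apply, if_pos (ht r)]
      exact one_ne_zero
  refine ⟨U, ⟨?_, ⟨s, hsU⟩, isStaircase_of_forall_isTransversal hsU fun t ht => (htU t ht).1,
    columns_mem_cliqueComplex hnonface hsU htU⟩, hUu⟩
  rw [hU, Finset.card_image_of_injective _ hinj, Finset.card_univ, Fintype.card_sum,
    Fintype.card_fin, Fintype.card_fin, add_comm]

theorem IsBlockSet.coeff_tuple_ne_zero {U : Finset (Fin n ×ₗ Fin m)} (hU : IsBlockSet Δ i U)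
    (hc : c ∈ koszulCycles P i) (hdiag : IsDiagonalAt c (setExp U)) {s : Fin n → Fin m}
    (hs : s ∈ diagonalsAt c (setExp U)) :
    coeff (tupleExp (diag hU.transversal)) (c hU.tuple) ≠ 0 := by
  obtain ⟨v, hv, hne⟩ := mem_diagonalsAt_of_forall_ne_zero hc hdiag hs
    (t := hU.transversal) fun r => by
      rw [setExp_apply, if_pos (hU.isTransversal_transversal r)]
      exact one_ne_zero
  rw [← hU.tupleExp_tuple_add_tupleExp_diag, add_left_inj] at hv
  obtain ⟨π, rfl⟩ := exists_perm_of_tupleExp_eq hU.tuple_injective hv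
  rcases hc.2.1.apply_comp_perm_eq_or hU.tuple π with h | h
  · rwa [h] at hne
  · rwa [h, coeff_neg, neg_ne_zero] at hne

/-- The coefficients of a cycle at the chosen transversals of the block sets; they determine the
cycle. -/
noncomputable def blockCoeff (Δ : PreAbstractSimplicialComplex (Fin m)) (i : ℕ)
    (P : Submodule k (PolyRing k n m)) :
    koszulCycles P i →ₗ[k] ({U : Finset (Fin n ×ₗ Fin m) // IsBlockSet Δ i U} → k) :=
  LinearMap.pi fun U => lcoeff k (tupleExp (diag U.2.transversal)) ∘ₗ
    LinearMap.proj U.2.tuple ∘ₗ (koszulCycles P i).subtype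

/-- The leading exponents of the nonzero elements of `P` are the diagonals of faces of `Δ`. -/
def HasFaceLeadingExponents (Δ : PreAbstractSimplicialComplex (Fin m))
    (P : Submodule k (PolyRing k n m)) : Prop :=
  ∀ p ∈ P, p ≠ 0 → ∃ s, IsFaceTuple Δ s ∧ MonomialOrder.lex.degree p = tupleExp (diag s)

theorem HasFaceLeadingExponents.exists_mem_diagonalsAt (hP : HasFaceLeadingExponents Δ P)
    (hc : ∀ v, c v ∈ P) (hne : c ≠ 0) :
    ∃ u, IsDiagonalAt c u ∧ (∀ s ∈ diagonalsAt c u, IsFaceTuple Δ s) ∧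
      (diagonalsAt c u).Nonempty := by
  classical
  obtain ⟨v₀, hv₀⟩ := Function.ne_iff.1 hne
  obtain ⟨v, hv, hmax⟩ := Finset.exists_max_image {v | c v ≠ 0}
    (fun v => MonomialOrder.lex.toSyn (tupleExp v + MonomialOrder.lex.degree (c v)))
    ⟨v₀, (Finset.mem_filter_univ v₀).2 hv₀⟩
  rw [Finset.mem_filter_univ] at hv
  have key (v' : Fin i → Fin n ×ₗ Fin m) (e : (Fin n ×ₗ Fin m) →₀ ℕ)
      (hu : tupleExp v' + e = tupleExp v + MonomialOrder.lex.degree (c v))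
      (he : coeff e (c v') ≠ 0) : ∃ s, IsFaceTuple Δ s ∧ e = tupleExp (diag s) := by
    have hv' : c v' ≠ 0 := by
      rintro h
      exact he (by rw [h, coeff_zero])
    have hle := hmax v' ((Finset.mem_filter_univ v').2 hv')
    rw [← hu, map_add, map_add, add_le_add_iff_left] at hle
    obtain ⟨s, hs, hdeg⟩ := hP _ (hc v') hv'
    refine ⟨s, hs, MonomialOrder.lex.toSyn.injective (le_antisymm ?_ ?_)⟩
    · rw [← hdeg]
      exact MonomialOrder.lex.le_degree (mem_support_iff.2 he)
    · rwa [← hdeg]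
  refine ⟨_, fun v' e hu he => (key v' e hu he).imp fun _ => And.right, ?_, ?_⟩
  · rintro s ⟨v', hu, hs⟩
    obtain ⟨s', hs', heq⟩ := key v' _ hu hs
    rwa [tupleExp_diag_injective heq]
  · obtain ⟨s, -, hs⟩ := hP _ (hc v) hv
    refine ⟨s, v, by rw [hs], ?_⟩
    rw [← hs]
    exact MonomialOrder.lex.coeff_degree_ne_zero_iff.2 hv

theorem blockCoeff_injective
    (hnonface : ∀ σ : Finset (Fin m), σ.card = n + 1 → ¬ IsINonface (cliqueComplex n Δ) 1 σ)
    (hP : HasFaceLeadingExponents Δ P) : Function.Injective (blockCoeff Δ i P) := by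
  rw [injective_iff_map_eq_zero]
  rintro ⟨c, hc⟩ h0
  by_contra hne
  obtain ⟨u, hdiag, hface, s, hs⟩ :=
    hP.exists_mem_diagonalsAt hc.1 fun h => hne (Subtype.ext h)
  obtain ⟨U, hU, rfl⟩ := exists_isBlockSet_setExp_eq hnonface hc hdiag hface hs
  exact hU.coeff_tuple_ne_zero hc hdiag hs (congrFun h0 ⟨U, hU⟩)

end UpperBound

/-! ### Maximal minors and their leading exponents -/

section Minors

variable (k : Type*) [Field k] {n m : ℕ}

/-- The maximal minor of the generic matrix on the columns `t_1, …, t_n`, in this order. -/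
noncomputable def columnMinor (t : Fin n → Fin m) : PolyRing k n m :=
  ((genericMatrix k n m).submatrix id t).det

variable {k}

theorem columnMinor_eq_sum (t : Fin n → Fin m) :
    columnMinor k t = ∑ π : Equiv.Perm (Fin n),
      Equiv.Perm.sign π • monomial (tupleExp (diag (t ∘ π))) (1 : k) := by
  rw [columnMinor, ← Matrix.det_transpose, Matrix.det_apply]
  refine Finset.sum_congr rfl fun π _ => ?_
  rw [← prod_X_eq_monomial_tupleExp]
  rfl

theorem columnMinor_comp_perm (t : Fin n → Fin m) (π : Equiv.Perm (Fin n)) :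
    columnMinor k (t ∘ π) = ((Equiv.Perm.sign π : ℤ) : PolyRing k n m) * columnMinor k t :=
  Matrix.det_permute' π ((genericMatrix k n m).submatrix id t)

theorem exists_perm_of_coeff_columnMinor {t : Fin n → Fin m} {e : (Fin n ×ₗ Fin m) →₀ ℕ}
    (h : coeff e (columnMinor k t) ≠ 0) :
    ∃ π : Equiv.Perm (Fin n), e = tupleExp (diag (t ∘ π)) := by
  rw [columnMinor_eq_sum, coeff_sum] at h
  obtain ⟨π, -, hπ⟩ := Finset.exists_ne_zero_of_sum_ne_zero h
  refine ⟨π, ?_⟩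
  by_contra hne
  exact hπ (by rw [Units.smul_def, coeff_smul, coeff_monomial, if_neg (Ne.symm hne), smul_zero])

theorem isHomogeneous_columnMinor (t : Fin n → Fin m) : (columnMinor k t).IsHomogeneous n := by
  rw [isHomogeneous_iff_degree_eq]
  intro e he
  obtain ⟨π, rfl⟩ := exists_perm_of_coeff_columnMinor (mem_support_iff.1 he)
  rw [degree_tupleExp, Fintype.card_fin]

theorem coeff_tupleExp_diag_columnMinor {t : Fin n → Fin m} (ht : Function.Injective t) :
    coeff (tupleExp (diag t)) (columnMinor k t) = 1 := by
  rw [columnMinor_eq_sum, coeff_sum, Finset.sum_eq_single 1]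
  · simp
  · intro π _ hπ
    rw [Units.smul_def, coeff_smul, coeff_monomial, if_neg, smul_zero]
    exact fun h => hπ (Equiv.ext fun q => ht (congrFun (tupleExp_diag_injective h) q))
  · simp

theorem columnMinor_ne_zero {t : Fin n → Fin m} (ht : Function.Injective t) :
    columnMinor k t ≠ 0 := fun h =>
  one_ne_zero (α := k) (by rw [← coeff_tupleExp_diag_columnMinor ht, h, coeff_zero])

theorem degree_columnMinor {s : Fin n → Fin m} (hs : StrictMono s) :
    MonomialOrder.lex.degree (columnMinor k s) = tupleExp (diag s) := by
  refine MonomialOrder.lex.toSyn.injective (le_antisymm ?_ (MonomialOrder.lex.le_degree ?_))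
  · obtain ⟨π, hπ⟩ := exists_perm_of_coeff_columnMinor
      (MonomialOrder.lex.coeff_degree_ne_zero_iff.2 (columnMinor_ne_zero (k := k) hs.injective))
    rw [hπ]
    exact lex_tupleExp_diag_comp_perm_le hs π
  · rw [mem_support_iff, coeff_tupleExp_diag_columnMinor hs.injective]
    exact one_ne_zero

theorem exists_degree_eq_of_mem_span {R σ τ : Type*} [CommRing R] [NoZeroDivisors R]
    (mo : MonomialOrder σ) {f : τ → MvPolynomial σ R} (hf : ∀ s, f s ≠ 0)
    (hinj : Function.Injective fun s => mo.degree (f s)) {p : MvPolynomial σ R}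
    (hp : p ∈ Submodule.span R (Set.range f)) (hne : p ≠ 0) :
    ∃ s, mo.degree p = mo.degree (f s) := by
  obtain ⟨c, rfl⟩ := Finsupp.mem_span_range_iff_exists_finsupp.1 hp
  have hc : c.support.Nonempty := by
    rw [Finsupp.support_nonempty_iff]
    rintro rfl
    exact hne Finsupp.sum_zero_index
  obtain ⟨s, hs, hmax⟩ := Finset.exists_max_image c.support
    (fun s => mo.toSyn (mo.degree (f s))) hc
  refine ⟨s, mo.toSyn.injective (le_antisymm ?_ (mo.le_degree ?_))⟩
  · refine mo.degree_sum_le.trans (Finset.sup_le fun t ht => ?_)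
    exact mo.degree_smul_le.trans (hmax t ht)
  · rw [mem_support_iff, Finsupp.sum, coeff_sum, Finset.sum_eq_single s]
    · rw [coeff_smul, smul_eq_mul]
      exact mul_ne_zero (Finsupp.mem_support_iff.1 hs) (mo.coeff_degree_ne_zero_iff.2 (hf s))
    · intro t ht hts
      rw [coeff_smul, mo.coeff_eq_zero_of_lt, smul_zero]
      exact (hmax t ht).lt_of_ne fun h => hts (hinj (mo.toSyn.injective h))
    · exact fun h => absurd hs h

end Minors

/-! ### The facet ideal and its initial ideal in degree `n` -/

theorem homogeneousComponent_mem_span_of_isHomogeneous {R ι : Type*} [CommRing R] {d : ℕ}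
    {S : Set (MvPolynomial ι R)} (hS : ∀ p ∈ S, p.IsHomogeneous d) {p : MvPolynomial ι R}
    (hp : p ∈ Ideal.span S) : homogeneousComponent d p ∈ Submodule.span R S := by
  have h := homogeneousComponent_mem_span
    (fun q hq => mem_pow_idealOfVars_of_isHomogeneous (hS q hq)) hp
  rwa [Set.image_congr (g := id), Set.image_id] at h
  exact fun q hq => homogeneousComponent_of_mem (hS q hq) |>.trans (if_pos rfl)

section FacetIdeal

variable {k : Type*} [Field k] {n m : ℕ} {Δ : PreAbstractSimplicialComplex (Fin m)}

theorem isHomogeneous_maximalMinor {σ : Finset (Fin m)} (hσ : σ.card = n) :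
    (maximalMinor k σ hσ).IsHomogeneous n :=
  isHomogeneous_columnMinor _

theorem columnMinor_mem_facetIdeal (hdim : ∀ σ ∈ Δ, σ.card ≤ n) {t : Fin n → Fin m}
    (ht : Function.Injective t) (hΔ : Finset.univ.image t ∈ Δ) :
    columnMinor k t ∈ facetIdeal k n Δ := by
  have hcard : (Finset.univ.image t).card = n := by
    rw [Finset.card_image_of_injective _ ht, Finset.card_univ, Fintype.card_fin]
  have hemb := ((Finset.univ.image t).orderEmbOfFin hcard).injective
  obtain ⟨π, hπ⟩ := exists_perm_of_tupleExp_eq hemb (v' := t) (by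
    rw [tupleExp_eq_setExp ht, tupleExp_eq_setExp hemb, Finset.image_orderEmbOfFin_univ])
  rw [hπ, columnMinor_comp_perm]
  exact Ideal.mul_mem_left _ _ <| Ideal.subset_span
    ⟨_, isFacet_of_card_le hΔ fun τ hτ => (hdim τ hτ).trans_eq hcard.symm, hcard, rfl⟩

theorem facetIdeal_le_pow_idealOfVars :
    facetIdeal k n Δ ≤ idealOfVars (Fin n ×ₗ Fin m) k ^ n := by
  rw [facetIdeal, Ideal.span_le]
  rintro _ ⟨σ, _, hσ, rfl⟩
  exact mem_pow_idealOfVars_of_isHomogeneous (isHomogeneous_maximalMinor hσ)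

theorem homogeneousComponent_mem_facetIdeal {p : PolyRing k n m} (hp : p ∈ facetIdeal k n Δ) :
    homogeneousComponent n p ∈ facetIdeal k n Δ := by
  refine Submodule.span_le_restrictScalars k (PolyRing k n m) _ <|
    homogeneousComponent_mem_span_of_isHomogeneous ?_ hp
  rintro _ ⟨σ, _, hσ, rfl⟩
  exact isHomogeneous_maximalMinor hσ

theorem homogeneousPart_facetIdeal_le_span_columnMinor :
    homogeneousPart (facetIdeal k n Δ) n ≤
      Submodule.span k (Set.range fun s : {s // IsFaceTuple Δ s} => columnMinor k s.1) := by
  rintro p ⟨hp, hpn⟩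
  have h := homogeneousComponent_mem_span_of_isHomogeneous (d := n) (by
    rintro _ ⟨σ, _, hσ, rfl⟩
    exact isHomogeneous_maximalMinor hσ) hp
  rw [homogeneousComponent_of_mem hpn, if_pos rfl] at h
  refine Submodule.span_mono ?_ h
  rintro _ ⟨σ, hσΔ, hσ, rfl⟩
  refine ⟨⟨σ.orderEmbOfFin hσ, (σ.orderEmbOfFin hσ).strictMono, ?_⟩, rfl⟩
  rw [Finset.image_orderEmbOfFin_univ]
  exact hσΔ.1

theorem hasFaceLeadingExponents_facetIdeal :
    HasFaceLeadingExponents Δ (homogeneousPart (facetIdeal k n Δ) n) := by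
  intro p hp hne
  have hinj : Function.Injective fun s : {s : Fin n → Fin m // IsFaceTuple Δ s} =>
      MonomialOrder.lex.degree (columnMinor k s.1) := fun s t hst => by
    simp only [degree_columnMinor s.2.1, degree_columnMinor t.2.1] at hst
    exact Subtype.ext (tupleExp_diag_injective hst)
  obtain ⟨s, hs⟩ := exists_degree_eq_of_mem_span MonomialOrder.lex
    (fun s => columnMinor_ne_zero s.2.1.injective) hinj
    (homogeneousPart_facetIdeal_le_span_columnMinor hp) hne
  exact ⟨s, s.2, hs.trans (degree_columnMinor s.2.1)⟩

end FacetIdeal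

section InitialIdeal

variable {k : Type*} [Field k] {n m d : ℕ} {I : Ideal (PolyRing k n m)}

theorem leadingTerm_mem_pow_idealOfVars {σ R : Type*} [CommRing R] (mo : MonomialOrder σ)
    {p : MvPolynomial σ R} (hp : p ∈ idealOfVars σ R ^ d) :
    mo.leadingTerm p ∈ idealOfVars σ R ^ d := by
  classical
  rw [mem_pow_idealOfVars_iff] at hp ⊢
  intro e he
  rw [mo.support_leadingTerm] at he
  split_ifs at he with h
  · exact absurd he (Finset.notMem_empty e)
  · rw [Finset.mem_singleton.1 he]
    exact hp _ (mo.degree_mem_support h)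

theorem initialIdeal_le_pow_idealOfVars (hI : I ≤ idealOfVars (Fin n ×ₗ Fin m) k ^ d) :
    initialIdeal I ≤ idealOfVars (Fin n ×ₗ Fin m) k ^ d := by
  rw [initialIdeal, Ideal.span_le]
  rintro _ ⟨p, hp, rfl⟩
  exact leadingTerm_mem_pow_idealOfVars _ (hI hp)

theorem degree_homogeneousComponent {σ R : Type*} [CommRing R] (mo : MonomialOrder σ)
    {p : MvPolynomial σ R} (hne : p ≠ 0) :
    mo.degree (homogeneousComponent (mo.degree p).degree p) = mo.degree p := by
  refine mo.toSyn.injective (le_antisymm ?_ (mo.le_degree ?_))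
  · refine mo.degree_le_iff.2 fun e he => mo.le_degree ?_
    rw [mem_support_iff, coeff_homogeneousComponent] at he
    exact mem_support_iff.2 (ite_ne_right_iff.1 he).2
  · rw [mem_support_iff, coeff_homogeneousComponent, if_pos rfl]
    exact mo.coeff_degree_ne_zero_iff.2 hne

theorem homogeneousPart_initialIdeal_le (hI : I ≤ idealOfVars (Fin n ×ₗ Fin m) k ^ d)
    (hId : ∀ p ∈ I, homogeneousComponent d p ∈ I) :
    homogeneousPart (initialIdeal I) d ≤ restrictSupport k
      {e | ∃ q ∈ homogeneousPart I d, q ≠ 0 ∧ MonomialOrder.lex.degree q = e} := by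
  rintro p ⟨hp, hpd⟩
  have hspan := homogeneousComponent_mem_span (d := d) (by
    rintro _ ⟨q, hq, rfl⟩
    exact leadingTerm_mem_pow_idealOfVars _ (hI hq)) hp
  rw [homogeneousComponent_of_mem hpd, if_pos rfl] at hspan
  refine Submodule.span_le.2 ?_ hspan
  rintro _ ⟨_, ⟨q, hq, rfl⟩, rfl⟩
  refine (mem_restrictSupport_iff k).2 fun e he => ?_
  rw [Finset.mem_coe, mem_support_iff, coeff_homogeneousComponent, ite_ne_right_iff,
    MonomialOrder.leadingTerm, coeff_monomial, ite_ne_right_iff] at he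
  obtain ⟨rfl, rfl, hlead⟩ := he
  have hq0 : q ≠ 0 := MonomialOrder.leadingCoeff_ne_zero_iff.1 hlead
  have hdeg := degree_homogeneousComponent MonomialOrder.lex hq0
  refine ⟨_, ⟨hId q hq, homogeneousComponent_isHomogeneous _ q⟩, fun h0 => hlead ?_, hdeg⟩
  have hcoeff := coeff_homogeneousComponent (MonomialOrder.lex.degree q).degree
    (d := MonomialOrder.lex.degree q) q
  rw [h0, coeff_zero, if_pos rfl] at hcoeff
  exact hcoeff.symm

theorem HasFaceLeadingExponents.initialIdeal {Δ : PreAbstractSimplicialComplex (Fin m)}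
    (hI : I ≤ idealOfVars (Fin n ×ₗ Fin m) k ^ d)
    (hId : ∀ p ∈ I, homogeneousComponent d p ∈ I)
    (hΔ : HasFaceLeadingExponents Δ (homogeneousPart I d)) :
    HasFaceLeadingExponents Δ (homogeneousPart (initialIdeal I) d) := by
  intro p hp hne
  obtain ⟨q, hq, hq0, hdeg⟩ := (mem_restrictSupport_iff k).1
    (homogeneousPart_initialIdeal_le hI hId hp) (MonomialOrder.lex.degree_mem_support hne)
  rw [← hdeg]
  exact hΔ q hq hq0

end InitialIdeal

/-! ### Eagon–Northcott cycles -/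

section EagonNorthcott

variable (k : Type*) [Field k] {n m i : ℕ}

/-- The unit row vectors at the columns `a_1, …, a_i`, followed by the rows of the generic matrix,
all restricted to the columns `e`. The maximal minors of the generic matrix on `n` of the columns
`e` are the determinants of such matrices. -/
noncomputable def unitBorderedMatrix (e : Fin i ⊕ Fin n → Fin m) (a : Fin i → Fin m) :
    Matrix (Fin i ⊕ Fin n) (Fin i ⊕ Fin n) (PolyRing k n m) :=
  ((Matrix.fromRows ((1 : Matrix (Fin m) (Fin m) (PolyRing k n m)).submatrix a id)
    (genericMatrix k n m))).submatrix id e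

/-- The Koszul cycle given by the Eagon–Northcott complex of the columns `e` and a monomial in the
rows with exponent `α`. -/
noncomputable def eagonNorthcottCycle (e : Fin i ⊕ Fin n → Fin m) (α : Fin n →₀ ℕ)
    (v : Fin i → Fin n ×ₗ Fin m) : PolyRing k n m :=
  if tupleExp (row ∘ v) = α then (unitBorderedMatrix k e (col ∘ v)).det else 0

variable {k} {e : Fin i ⊕ Fin n → Fin m}

theorem det_unitBorderedMatrix_of_perm (he : Function.Injective e) {a : Fin i → Fin m}
    (π : Equiv.Perm (Fin i ⊕ Fin n)) (hπ : e ∘ π ∘ Sum.inl = a) :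
    (unitBorderedMatrix k e a).det =
      (Equiv.Perm.sign π : ℤ) • columnMinor k (e ∘ π ∘ Sum.inr) := by
  subst hπ
  have hinj : Function.Injective (e ∘ π) := he.comp π.injective
  have hblocks : (unitBorderedMatrix k e (e ∘ π ∘ Sum.inl)).submatrix id π =
      Matrix.fromBlocks 1 0 ((genericMatrix k n m).submatrix id (e ∘ π ∘ Sum.inl))
        ((genericMatrix k n m).submatrix id (e ∘ π ∘ Sum.inr)) := by
    refine Matrix.ext_iff_blocks.2 ⟨?_, ?_, rfl, rfl⟩
    · exact Matrix.submatrix_one _ (hinj.comp Sum.inl_injective)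
    · ext1 j r
      exact Matrix.one_apply_ne fun h => Sum.inl_ne_inr (hinj h)
  have hdet := Matrix.det_permute' π (unitBorderedMatrix k e (e ∘ π ∘ Sum.inl))
  rw [hblocks, Matrix.det_fromBlocks_zero₁₂, Matrix.det_one, one_mul] at hdet
  rw [columnMinor, hdet, zsmul_eq_mul, ← mul_assoc, ← Int.cast_mul, ← Units.val_mul,
    Int.units_mul_self, Units.val_one, Int.cast_one, one_mul]

theorem exists_perm_of_det_unitBorderedMatrix_ne_zero {a : Fin i → Fin m}
    (h : (unitBorderedMatrix k e a).det ≠ 0) :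
    ∃ π : Equiv.Perm (Fin i ⊕ Fin n), e ∘ π ∘ Sum.inl = a := by
  rw [← Matrix.det_transpose, Matrix.det_apply] at h
  obtain ⟨π, -, hπ⟩ := Finset.exists_ne_zero_of_sum_ne_zero h
  rw [Units.smul_def] at hπ
  refine ⟨π, funext fun j => ?_⟩
  by_contra hne
  exact right_ne_zero_of_smul hπ <| Finset.prod_eq_zero (Finset.mem_univ (Sum.inl j)) <|
    Matrix.one_apply_ne (Ne.symm hne)

theorem isAlternating_det_unitBorderedMatrix :
    IsAlternating fun a : Fin i → Fin m => (unitBorderedMatrix k e a).det where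
  apply_eq_zero a ha := by
    simp only [Function.Injective, not_forall] at ha
    obtain ⟨j, l, h, hne⟩ := ha
    refine Matrix.det_zero_of_row_eq (i := Sum.inl j) (j := Sum.inl l)
      (Sum.inl_injective.ne hne) (funext fun x => ?_)
    exact congrFun (congrArg (1 : Matrix (Fin m) (Fin m) (PolyRing k n m)) h) (e x)
  apply_comp_perm a π := by
    have hmat : unitBorderedMatrix k e (a ∘ π) =
        (unitBorderedMatrix k e a).submatrix (Equiv.Perm.sumCongr π 1) id := by
      ext1 (j | r) x <;> rfl
    rw [hmat, Matrix.det_permute, Equiv.Perm.sign_sumCongr, Equiv.Perm.sign_one, mul_one,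
      Units.smul_def, zsmul_eq_mul]

/-- Replacing the `j`-th unit vector by row `r` of the generic matrix makes two rows equal. -/
theorem sum_X_mul_det_unitBorderedMatrix_update (a : Fin i → Fin m) (j : Fin i) (r : Fin n) :
    ∑ b, X (toLex (r, b)) * (unitBorderedMatrix k e (Function.update a j b)).det = 0 := by
  have hupdate (b : Fin m) : unitBorderedMatrix k e (Function.update a j b) =
      (unitBorderedMatrix k e a).updateRow (Sum.inl j) (Pi.single b 1 ∘ e) := by
    ext1 (l | q) x
    · rcases eq_or_ne l j with rfl | hl
      · rw [Matrix.updateRow_self, Function.comp_apply, ← Matrix.one_eq_pi_single]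
        exact congrArg (fun c => (1 : Matrix (Fin m) (Fin m) (PolyRing k n m)) c (e x))
          (Function.update_self l b a)
      · rw [Matrix.updateRow_ne (Sum.inl_injective.ne hl)]
        exact congrArg (fun c => (1 : Matrix (Fin m) (Fin m) (PolyRing k n m)) c (e x))
          (Function.update_of_ne hl b a)
    · rw [Matrix.updateRow_ne Sum.inr_ne_inl]
      rfl
  have hrow : ∑ b, (X (toLex (r, b)) : PolyRing k n m) • (Pi.single b 1 ∘ e) =
      unitBorderedMatrix k e a (Sum.inr r) := by
    funext x
    simp only [Finset.sum_apply, Pi.smul_apply, Function.comp_apply, smul_eq_mul,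
      Pi.single_apply, mul_ite, mul_one, mul_zero, Finset.sum_ite_eq, Finset.mem_univ, if_true]
    rfl
  let detRow := Matrix.detRowAlternating.toMultilinearMap.toLinearMap
    (unitBorderedMatrix k e a) (Sum.inl j)
  have hdet (x : Fin i ⊕ Fin n → PolyRing k n m) :
    detRow x = ((unitBorderedMatrix k e a).updateRow (Sum.inl j) x).det := rfl
  simp only [hupdate, ← hdet, ← smul_eq_mul, ← map_smul, ← map_sum]
  rw [hrow, hdet]
  refine Matrix.det_zero_of_row_eq (i := Sum.inl j) (j := Sum.inr r) Sum.inl_ne_inr ?_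
  rw [Matrix.updateRow_self, Matrix.updateRow_ne Sum.inr_ne_inl]

theorem eagonNorthcottCycle_mem_koszulCycles {α : Fin n →₀ ℕ}
    {P : Submodule k (PolyRing k n m)} (hP : ∀ v, eagonNorthcottCycle k e α v ∈ P) :
    eagonNorthcottCycle k e α ∈ koszulCycles P i := by
  refine ⟨hP, ⟨fun v hv => ?_, fun v π => ?_⟩, fun v j => ?_⟩
  · rw [eagonNorthcottCycle, isAlternating_det_unitBorderedMatrix.apply_eq_zero _
      fun h => hv h.of_comp, ite_self]
  · rw [eagonNorthcottCycle, eagonNorthcottCycle, ← Function.comp_assoc, ← Function.comp_assoc,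
      tupleExp_comp_equiv, isAlternating_det_unitBorderedMatrix.apply_comp_perm, smul_ite,
      smul_zero]
  · rw [← Equiv.sum_comp (toLex : Fin n × Fin m ≃ Fin n ×ₗ Fin m), Fintype.sum_prod_type]
    refine Finset.sum_eq_zero fun r _ => ?_
    simp only [eagonNorthcottCycle, Function.comp_update]
    change ∑ b, X (toLex (r, b)) * (if tupleExp (Function.update (row ∘ v) j r) = α then
      (unitBorderedMatrix k e (Function.update (col ∘ v) j b)).det else 0) = 0
    split_ifs
    · exact sum_X_mul_det_unitBorderedMatrix_update _ j r
    · simp only [mul_zero, Finset.sum_const_zero]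

end EagonNorthcott

/-! ### Leading multidegrees of Koszul cycles -/

section LeadingMultidegree

variable {R ι κ : Type*} [CommRing R] [Fintype κ]

/-- `u` is the largest multidegree occurring in `c`, where the term `x^e` of `c v` has multidegree
`tupleExp v + e`: the variable `x_w` and the basis vector `e_w` of the Koszul complex have the same
multidegree. -/
def HasLeadingMultidegree (mo : MonomialOrder ι) (c : (κ → ι) → MvPolynomial ι R)
    (u : ι →₀ ℕ) : Prop :=
  (∃ v e, coeff e (c v) ≠ 0 ∧ tupleExp v + e = u) ∧
    ∀ v e, coeff e (c v) ≠ 0 → mo.toSyn (tupleExp v + e) ≤ mo.toSyn u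

theorem linearIndependent_of_hasLeadingMultidegree [NoZeroDivisors R] {mo : MonomialOrder ι}
    {τ : Type*} {c : τ → (κ → ι) → MvPolynomial ι R} {u : τ → ι →₀ ℕ}
    (hu : Function.Injective u) (hc : ∀ t, HasLeadingMultidegree mo (c t) (u t)) :
    LinearIndependent R c := by
  rw [linearIndependent_iff]
  intro g hg
  by_contra hne
  obtain ⟨t, ht, hmax⟩ := Finset.exists_max_image g.support (fun t => mo.toSyn (u t))
    (Finsupp.support_nonempty_iff.2 hne)
  obtain ⟨v, e, he, hve⟩ := (hc t).1
  have h := congrArg (coeff e) (congrFun hg v)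
  rw [Finsupp.linearCombination_apply, Finsupp.sum, Finset.sum_apply, coeff_sum,
    Finset.sum_eq_single_of_mem t ht] at h
  · exact mul_ne_zero (Finsupp.mem_support_iff.1 ht) he h
  · intro t' ht' hne'
    by_contra h'
    have hle := (hc t').2 v e (right_ne_zero_of_mul h')
    rw [hve] at hle
    exact hne' (hu (mo.toSyn.injective (le_antisymm (hmax t' ht') hle)))

/-- The component of multidegree `u` of `c`. -/
noncomputable def component (u : ι →₀ ℕ) (c : (κ → ι) → MvPolynomial ι R) (v : κ → ι) :
    MvPolynomial ι R :=
  open Classical in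
  if tupleExp v ≤ u then monomial (u - tupleExp v) (coeff (u - tupleExp v) (c v)) else 0

variable {c : (κ → ι) → MvPolynomial ι R} {u : ι →₀ ℕ}

theorem coeff_component [DecidableEq ι] (u : ι →₀ ℕ) (c : (κ → ι) → MvPolynomial ι R) (v : κ → ι)
    (e : ι →₀ ℕ) : coeff e (component u c v) = if tupleExp v + e = u then coeff e (c v) else 0 := by
  rw [component]
  split_ifs with hle h h
  · rw [← h, add_tsub_cancel_left, coeff_monomial, if_pos rfl]
  · rw [coeff_monomial, if_neg]
    rintro rfl
    exact h (add_tsub_cancel_of_le hle)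
  · exact absurd (h ▸ le_self_add) hle
  · exact coeff_zero _

theorem HasLeadingMultidegree.component {mo : MonomialOrder ι}
    (hc : HasLeadingMultidegree mo c u) : HasLeadingMultidegree mo (component u c) u := by
  classical
  obtain ⟨v, e, he, hve⟩ := hc.1
  refine ⟨⟨v, e, by rwa [coeff_component, if_pos hve], hve⟩, fun v e he => ?_⟩
  rw [coeff_component, ite_ne_right_iff] at he
  rw [he.1]

theorem HasLeadingMultidegree.component_eq_leadingTerm {mo : MonomialOrder ι}
    (hc : HasLeadingMultidegree mo c u) {v : κ → ι} (hv : DetFacet.component u c v ≠ 0) :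
    DetFacet.component u c v = mo.leadingTerm (c v) := by
  classical
  obtain ⟨e, he⟩ := MvPolynomial.ne_zero_iff.1 hv
  rw [coeff_component, ite_ne_right_iff] at he
  obtain ⟨rfl, he⟩ := he
  have hdeg : mo.degree (c v) = e := by
    refine mo.toSyn.injective (le_antisymm (mo.degree_le_iff.2 fun e' he' => ?_)
      (mo.le_degree (mem_support_iff.2 he)))
    have hle := hc.2 v e' (mem_support_iff.1 he')
    rwa [map_add, map_add, add_le_add_iff_left] at hle
  ext e'
  rw [coeff_component, MonomialOrder.leadingTerm, MonomialOrder.leadingCoeff, hdeg, coeff_monomial]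
  refine (if_congr ((add_right_inj _).trans eq_comm) rfl rfl).trans ?_
  split_ifs with h
  · rw [h]
  · rfl

theorem sum_X_mul_component [Fintype ι] [DecidableEq κ] {v : κ → ι} {j : κ}
    (h : ∑ w, X w * c (Function.update v j w) = 0) :
    ∑ w, X w * component u c (Function.update v j w) = 0 := by
  classical
  ext e
  have hterm (w : ι) : coeff e (X w * component u c (Function.update v j w)) =
      if tupleExp v + e = u + Finsupp.single (v j) 1 then
        coeff e (X w * c (Function.update v j w)) else 0 := by
    rw [coeff_X_mul', coeff_X_mul']
    split_ifs with hw hu hu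
    on_goal 3 => rfl
    on_goal 3 => rfl
    all_goals
      have hsum : tupleExp (Function.update v j w) + (e - Finsupp.single w 1) +
          Finsupp.single (v j) 1 = tupleExp v + e := by
        rw [add_right_comm, tupleExp_update, add_assoc, add_tsub_cancel_of_le]
        exact Finsupp.single_le_iff.2 (Nat.one_le_iff_ne_zero.2 (Finsupp.mem_support_iff.1 hw))
      rw [← hsum, add_left_inj] at hu
      rw [coeff_component]
    · rw [if_pos hu]
    · rw [if_neg hu]
  have he := congrArg (coeff e) h
  rw [coeff_sum, coeff_zero] at he ⊢
  rw [Finset.sum_congr rfl fun w _ => hterm w]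
  split_ifs
  · exact he
  · exact Finset.sum_const_zero

theorem component_mem_koszulCycles [Fintype ι] {i : ℕ} {P P' : Submodule R (MvPolynomial ι R)}
    {c : (Fin i → ι) → MvPolynomial ι R} (hc : c ∈ koszulCycles P i)
    (hP' : ∀ v, component u c v ∈ P') : component u c ∈ koszulCycles P' i := by
  classical
  refine ⟨hP', ⟨fun v hv => ?_, fun v π => ?_⟩, fun v j => sum_X_mul_component (hc.2.2 v j)⟩
  · ext e
    rw [coeff_component, hc.2.1.apply_eq_zero v hv, coeff_zero, ite_self]
  · ext e
    rw [Units.smul_def, coeff_smul, coeff_component, coeff_component, tupleExp_comp_equiv,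
      hc.2.1.apply_comp_perm, Units.smul_def, coeff_smul, smul_ite, smul_zero]

theorem isHomogeneous_leadingTerm (mo : MonomialOrder ι) {d : ℕ} {p : MvPolynomial ι R}
    (hp : p.IsHomogeneous d) : (mo.leadingTerm p).IsHomogeneous d := by
  rcases eq_or_ne p 0 with rfl | hne
  · rwa [mo.leadingTerm_zero]
  · refine isHomogeneous_monomial _ ?_
    exact isHomogeneous_iff_degree_eq.1 hp _ (mo.degree_mem_support hne)

theorem HasLeadingMultidegree.component_mem_koszulCycles_initialIdeal {k : Type*} [Field k]
    {n m d i : ℕ} {I : Ideal (PolyRing k n m)} {c : (Fin i → Fin n ×ₗ Fin m) → PolyRing k n m}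
    {u : (Fin n ×ₗ Fin m) →₀ ℕ} (hcu : HasLeadingMultidegree MonomialOrder.lex c u)
    (hc : c ∈ koszulCycles (homogeneousPart I d) i) :
    DetFacet.component u c ∈ koszulCycles (homogeneousPart (initialIdeal I) d) i := by
  refine component_mem_koszulCycles hc fun v => ?_
  by_cases hv : DetFacet.component u c v = 0
  · rw [hv]
    exact Submodule.zero_mem _
  · rw [hcu.component_eq_leadingTerm hv]
    exact ⟨Ideal.subset_span ⟨_, (hc.1 v).1, rfl⟩, isHomogeneous_leadingTerm _ (hc.1 v).2⟩

end LeadingMultidegree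

/-! ### Cycles of block sets -/

namespace IsBlockSet

variable {k : Type*} [Field k] {n m i : ℕ} {Δ : PreAbstractSimplicialComplex (Fin m)}
  {U : Finset (Fin n ×ₗ Fin m)}

/-- The columns of a block set: first those outside the chosen transversal, then those of the
transversal. -/
noncomputable def cols (hU : IsBlockSet Δ i U) : Fin i ⊕ Fin n → Fin m :=
  col ∘ Sum.elim hU.tuple (diag hU.transversal)

theorem sumElim_injective (hU : IsBlockSet Δ i U) :
    Function.Injective (Sum.elim hU.tuple (diag hU.transversal)) := by
  refine hU.tuple_injective.sumElim (diag_injective _) fun j r h => ?_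
  exact (Finset.mem_sdiff.1 (Finset.orderEmbOfFin_mem _ hU.card_sdiff_transversal j)).2
    (Finset.mem_image.2 ⟨r, Finset.mem_univ r, h.symm⟩)

theorem sumElim_mem (hU : IsBlockSet Δ i U) :
    ∀ x, Sum.elim hU.tuple (diag hU.transversal) x ∈ U
  | Sum.inl j =>
    (Finset.mem_sdiff.1 (Finset.orderEmbOfFin_mem _ hU.card_sdiff_transversal j)).1
  | Sum.inr r => hU.isTransversal_transversal r

theorem cols_injective (hU : IsBlockSet Δ i U) : Function.Injective hU.cols := fun x y h =>
  hU.sumElim_injective (hU.isStaircase.strictMonoOn_col.injOn (hU.sumElim_mem x)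
    (hU.sumElim_mem y) h)

theorem setExp_eq_tupleExp (hU : IsBlockSet Δ i U) :
    setExp U = tupleExp (Sum.elim hU.tuple (diag hU.transversal)) := by
  rw [tupleExp_sumElim, hU.tupleExp_tuple_add_tupleExp_diag]

theorem columnMinor_mem_homogeneousPart (hU : IsBlockSet Δ i U) (hdim : ∀ σ ∈ Δ, σ.card ≤ n)
    {f : Fin n → Fin i ⊕ Fin n} (hf : Function.Injective f) :
    columnMinor k (hU.cols ∘ f) ∈ homogeneousPart (facetIdeal k n Δ) n := by
  have hinj := hU.cols_injective.comp hf
  refine ⟨columnMinor_mem_facetIdeal hdim hinj (hU.columns_mem.2 _ ?_ ?_),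
    isHomogeneous_columnMinor _⟩
  · exact Finset.image_subset_iff.2 fun r _ => Finset.mem_image_of_mem col (hU.sumElim_mem (f r))
  · rw [Finset.card_image_of_injective _ hinj, Finset.card_univ, Fintype.card_fin]

variable (k) in
/-- The Eagon–Northcott cycle of the facet ideal whose leading multidegree is the given block
set. -/
noncomputable def cycle (hU : IsBlockSet Δ i U) :
    (Fin i → Fin n ×ₗ Fin m) → PolyRing k n m :=
  eagonNorthcottCycle k hU.cols (tupleExp (row ∘ hU.tuple))

theorem cycle_mem_koszulCycles (hU : IsBlockSet Δ i U) (hdim : ∀ σ ∈ Δ, σ.card ≤ n) :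
    hU.cycle k ∈ koszulCycles (homogeneousPart (facetIdeal k n Δ) n) i := by
  refine eagonNorthcottCycle_mem_koszulCycles fun v => ?_
  rw [eagonNorthcottCycle]
  split_ifs
  swap
  · exact Submodule.zero_mem _
  by_cases hdet : (unitBorderedMatrix k hU.cols (col ∘ v)).det = 0
  · rw [hdet]
    exact Submodule.zero_mem _
  obtain ⟨π, hπ⟩ := exists_perm_of_det_unitBorderedMatrix_ne_zero hdet
  rw [det_unitBorderedMatrix_of_perm hU.cols_injective π hπ]
  exact zsmul_mem (hU.columnMinor_mem_homogeneousPart hdim (π.injective.comp Sum.inr_injective)) _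

theorem hasLeadingMultidegree_cycle (hU : IsBlockSet Δ i U) :
    HasLeadingMultidegree MonomialOrder.lex (hU.cycle k) (setExp U) := by
  refine ⟨⟨hU.tuple, tupleExp (diag hU.transversal), ?_, hU.tupleExp_tuple_add_tupleExp_diag⟩,
    fun v e he => ?_⟩
  · have hdet := det_unitBorderedMatrix_of_perm (k := k) (a := col ∘ hU.tuple)
      hU.cols_injective 1 rfl
    rw [Equiv.Perm.sign_one, Units.val_one, one_smul] at hdet
    rw [cycle, eagonNorthcottCycle, if_pos rfl, hdet]
    exact (coeff_tupleExp_diag_columnMinor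
      (hU.cols_injective.comp Sum.inr_injective)).trans_ne one_ne_zero
  · rw [cycle, eagonNorthcottCycle] at he
    split_ifs at he with hrow
    swap
    · exact absurd (coeff_zero e) he
    obtain ⟨π, hπ⟩ := exists_perm_of_det_unitBorderedMatrix_ne_zero fun h =>
      he (by rw [h, coeff_zero])
    rw [det_unitBorderedMatrix_of_perm hU.cols_injective π hπ, coeff_smul] at he
    obtain ⟨ρ, rfl⟩ := exists_perm_of_coeff_columnMinor (right_ne_zero_of_smul he)
    refine hU.isStaircase.lex_le_setExp ?_ ?_
    · rw [← hU.tupleExp_tuple_add_tupleExp_diag, Finsupp.mapDomain_add, Finsupp.mapDomain_add]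
      simp only [mapDomain_tupleExp]
      exact congrArg₂ _ hrow rfl
    · rw [hU.setExp_eq_tupleExp, Finsupp.mapDomain_add, mapDomain_tupleExp, mapDomain_tupleExp,
        mapDomain_tupleExp, ← tupleExp_comp_equiv (col ∘ _) π, ← hπ,
        ← Sum.elim_comp_inl_inr (_ ∘ π), tupleExp_sumElim]
      exact congrArg _ (tupleExp_comp_equiv (hU.cols ∘ π ∘ Sum.inr) ρ)

end IsBlockSet

/-! ### Betti numbers of the linear strands -/

section BettiNumbers

variable {k : Type*} [Field k] {n m i : ℕ} {Δ : PreAbstractSimplicialComplex (Fin m)}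

theorem finrank_koszulCycles_eq_card
    (hnonface : ∀ σ : Finset (Fin m), σ.card = n + 1 → ¬ IsINonface (cliqueComplex n Δ) 1 σ)
    {P : Submodule k (PolyRing k n m)} (hP : HasFaceLeadingExponents Δ P)
    (hcycles : ∀ U, IsBlockSet Δ i U →
      ∃ c ∈ koszulCycles P i, HasLeadingMultidegree MonomialOrder.lex c (setExp U)) :
    Module.finrank k (koszulCycles P i) =
      Nat.card {U : Finset (Fin n ×ₗ Fin m) // IsBlockSet Δ i U} := by
  classical
  have hinj := blockCoeff_injective (i := i) hnonface hP
  have : Module.Finite k (koszulCycles P i) := Module.Finite.of_injective _ hinj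
  choose c hc hlead using fun U : {U // IsBlockSet Δ i U} => hcycles U.1 U.2
  have hindep : LinearIndependent k fun U => (⟨c U, hc U⟩ : koszulCycles P i) :=
    .of_comp (koszulCycles P i).subtype <|
      linearIndependent_of_hasLeadingMultidegree (setExp_injective.comp Subtype.val_injective)
        hlead
  rw [Nat.card_eq_fintype_card]
  refine le_antisymm ?_ hindep.fintype_card_le_finrank
  exact (LinearMap.finrank_le_finrank_of_injective hinj).trans_eq
    (Module.finrank_fintype_fun_eq_card k)

theorem betti_facetIdeal_eq_card (hdim : ∀ σ ∈ Δ, σ.card ≤ n)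
    (hnonface : ∀ σ : Finset (Fin m), σ.card = n + 1 → ¬ IsINonface (cliqueComplex n Δ) 1 σ)
    (F : MinimalGradedFreeResolution (facetIdeal k n Δ)) (i : ℕ) :
    F.betti i (n + i) = Nat.card {U : Finset (Fin n ×ₗ Fin m) // IsBlockSet Δ i U} := by
  rw [F.betti_eq_finrank_koszulCycles facetIdeal_le_pow_idealOfVars]
  exact finrank_koszulCycles_eq_card hnonface hasFaceLeadingExponents_facetIdeal fun U hU =>
    ⟨hU.cycle k, hU.cycle_mem_koszulCycles hdim, hU.hasLeadingMultidegree_cycle⟩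

theorem betti_initialIdeal_facetIdeal_eq_card (hdim : ∀ σ ∈ Δ, σ.card ≤ n)
    (hnonface : ∀ σ : Finset (Fin m), σ.card = n + 1 → ¬ IsINonface (cliqueComplex n Δ) 1 σ)
    (G : MinimalGradedFreeResolution (initialIdeal (facetIdeal k n Δ))) (i : ℕ) :
    G.betti i (n + i) = Nat.card {U : Finset (Fin n ×ₗ Fin m) // IsBlockSet Δ i U} := by
  rw [G.betti_eq_finrank_koszulCycles
    (initialIdeal_le_pow_idealOfVars facetIdeal_le_pow_idealOfVars)]
  refine finrank_koszulCycles_eq_card hnonface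
    (hasFaceLeadingExponents_facetIdeal.initialIdeal facetIdeal_le_pow_idealOfVars
      fun _ => homogeneousComponent_mem_facetIdeal) fun U hU => ?_
  have hlead : HasLeadingMultidegree MonomialOrder.lex (hU.cycle k) (setExp U) :=
    hU.hasLeadingMultidegree_cycle
  exact ⟨component (setExp U) (hU.cycle k),
    hlead.component_mem_koszulCycles_initialIdeal (hU.cycle_mem_koszulCycles hdim),
    hlead.component⟩

end BettiNumbers

end DetFacet

theorem mainTheorem2_general (k : Type*) [Field k] (n m : ℕ)
    (Δ : PreAbstractSimplicialComplex (Fin m)) (hdim : ∀ σ ∈ Δ, σ.card ≤ n)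
    (hnonface : ∀ σ : Finset (Fin m), σ.card = n + 1 →
      ¬ DetFacet.IsINonface (DetFacet.cliqueComplex n Δ) 1 σ)
    (F : DetFacet.MinimalGradedFreeResolution (DetFacet.facetIdeal k n Δ))
    (G : DetFacet.MinimalGradedFreeResolution
      (DetFacet.initialIdeal (DetFacet.facetIdeal k n Δ))) (i : ℕ) :
    F.betti i (n + i) = G.betti i (n + i) :=
  (DetFacet.betti_facetIdeal_eq_card hdim hnonface F i).trans
    (DetFacet.betti_initialIdeal_facetIdeal_eq_card hdim hnonface G i).symm

theorem mainTheorem2 (k : Type*) [Field k] (n m : ℕ) (hn : 1 ≤ n) (hnm : n ≤ m)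
    (Δ : PreAbstractSimplicialComplex (Fin m)) (hpure : DetFacet.IsPureCard n Δ)
    (hnonface : ∀ σ : Finset (Fin m), σ.card = n + 1 →
      ¬ DetFacet.IsINonface (DetFacet.cliqueComplex n Δ) 1 σ)
    (F : DetFacet.MinimalGradedFreeResolution (DetFacet.facetIdeal k n Δ))
    (G : DetFacet.MinimalGradedFreeResolution
      (DetFacet.initialIdeal (DetFacet.facetIdeal k n Δ)))
    (i : ℕ) (hi : 1 ≤ i) :
    F.betti i (n + i) = G.betti i (n + i) :=
  mainTheorem2_general k n m Δ (fun _ hσ => hpure.card_le hσ) hnonface F G i
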